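/- Let $U\subset\mathbb R^{m}\times\mathbb R^{n}$ be an open coordinate domain with coordinates $q=(y^i,x^a)$ whose slices $\{x:(y,x)\in U\}$ are connected. Let $(g,\mu,J)$ be a cofactor system on $U$: $g$ is a Riemannian metric, $\mu$ a 1-form, and $J$ a nonsingular special conformal Killing tensor, that is, a $g$-symmetric $(1,1)$ tensor with $J_{\alpha\beta|\gamma}=\frac12(\alpha_\alpha g_{\beta\gamma}+\alpha_\beta g_{\alpha\gamma})$ for some 1-form $\alpha$, such that $D_J\mu:=d_J\mu+d(\mathrm{tr}J)\wedge\mu=0$. Suppose that it is a driven cofactor system: there is a distribution $K$ along the projection $\tau:TU\to U$ with $$\Phi(K)\subset K,\quad \nabla K\subset K,\quad D^V_ZK\subset K\ \ \forall Z,\quad d\mu(K,K)=0,\quad D^H\mu(K^\perp,K)\neq0,$$ where $\Phi$ (Jacobi endomorphism), $\nabla$ (dynamical covariant derivative) and $D^V,D^H$ (vertical and horizontal covariant derivatives) belong to the second-order field of the equations $\frac{d}{dt}\frac{\partial T}{\partial\dot q^\alpha}-\frac{\partial T}{\partial q^\alpha}=\mu_\alpha$, $T=\frac12g_{\alpha\beta}\dot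 q^\alpha\dot q^\beta$. Let the coordinates be adapted, $K=\mathrm{span}\{\partial/\partial x^a\}$, $K^\perp=\mathrm{span}\{\partial/\partial y^i\}$, and let the block $J_1=(J^i_j)$ be nonsingular. All data are smooth. Let $P_2$ be the projector onto $K$ along $K^\perp$, let $A_{(n)}$ be the coefficient of $a^{n-1}$ in the cofactor tensor of $J+aP_2$, let $W_{(n)}$ satisfy $A_{(n)}\mu=-dW_{(n)}$, and put $H_{(n)}=\frac12A_{(n)}^{\alpha\beta}p_\alpha p_\beta+W_{(n)}$. Let $V(x,y)$ satisfy $\mu_a=-\partial V/\partial x^a$ and let $\psi^i(x,y)$ satisfy $J^i_a=\partial\psi^i/\partial x^a$. Let $y(t)$ be a solution of the driving equations (the decoupled $y$-part of the equations of motion), and define $\tilde p_i(t)$ by $g_{ij}\dot y^j=p_i=J^j_i\tilde p_j$. The driven system along $y(t)$ has the Hamiltonian $h(x,p,t)=\frac12g^{ab}p_ap_b+V(x,y(t))$. Then the generating function $$F(x,\tilde p,t)=x^a\tilde p_a+\psi^i(x,y(t))\,\tilde p_i(t)$$ (of old positions and new momenta) generates the time-dependent canonical transformation $(x^a,p_a)\leftrightarrow(x^a,\tilde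 p_a)$ with $p_a=\tilde p_a+J^i_a\tilde p_i(t)$, and there is a function $c(t)$ of time alone such that the transformed Hamiltonian $\tilde h=h+\partial F/\partial t$ is $$\tilde h(x,\tilde p,t)=(\det J_1)^{-1}H_{(n)}+J^{ai}\tilde p_a\tilde p_i(t)+c(t),$$ where $H_{(n)}$ is expressed in the new variables by $p_i=J^j_i\tilde p_j(t)$, $p_a=\tilde p_a+J^i_a\tilde p_i(t)$, $J$ and $W_{(n)}$ are evaluated at $(y(t),x)$, and $J^{ai}=J^a_jg^{ji}$. -/

import Mathlib

open scoped ContDiff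

namespace DrivenCofactor

section General

variable {ι : Type} [Fintype ι] [DecidableEq ι]

/-! Local coordinates `q : ι → ℝ` on an open set `U` (the configuration manifold) and induced
coordinates `(q, v)` on its tangent bundle. Tensors of type (1,1) are matrices whose row index is
the upper and whose column index is the lower one. -/

/-- `∂F/∂q^α` for a function on the configuration space. -/
noncomputable def pd (α : ι) (F : (ι → ℝ) → ℝ) (q : ι → ℝ) : ℝ :=
  fderiv ℝ F q (Pi.single α 1)

/-- `∂F/∂q^α` for a function `F(q,v)` on the tangent bundle. -/
noncomputable def pdq (α : ι) (F : (ι → ℝ) → (ι → ℝ) → ℝ) (q v : ι → ℝ) : ℝ :=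
  pd α (fun q' => F q' v) q

/-- `V_α(F) = ∂F/∂v^α` for a function `F(q,v)` on the tangent bundle. -/
noncomputable def pdv (α : ι) (F : (ι → ℝ) → (ι → ℝ) → ℝ) (q v : ι → ℝ) : ℝ :=
  pd α (F q) v

/-- `g` is a smooth Riemannian metric on `U`. -/
structure IsRiemannianMetric (U : Set (ι → ℝ)) (g : (ι → ℝ) → Matrix ι ι ℝ) : Prop where
  smooth : ∀ α β, ContDiffOn ℝ ∞ (fun q => g q α β) U
  posDef : ∀ q ∈ U, (g q).PosDef

/-- Christoffel symbols `Γ^α_{βγ}` of the Levi-Civita connection of `g`. -/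
noncomputable def christoffel (g : (ι → ℝ) → Matrix ι ι ℝ) (q : ι → ℝ) (α β γ : ι) : ℝ :=
  (1 / 2) * ∑ σ, (g q)⁻¹ α σ *
    (pd β (fun q' => g q' σ γ) q + pd γ (fun q' => g q' σ β) q - pd σ (fun q' => g q' β γ) q)

/-- `J_{αβ|γ}`: covariant derivative of `J_{αβ} = g_{ασ} J^σ_β`. -/
noncomputable def covDerivLower (g J : (ι → ℝ) → Matrix ι ι ℝ) (q : ι → ℝ) (α β γ : ι) : ℝ :=
  pd γ (fun q' => (g q' * J q') α β) q
    - ∑ σ, christoffel g q σ α γ * (g q * J q) σ β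
    - ∑ σ, christoffel g q σ β γ * (g q * J q) α σ

/-- `J` is a special conformal Killing tensor of `g` on `U`. -/
structure IsSpecialConformalKilling (U : Set (ι → ℝ)) (g J : (ι → ℝ) → Matrix ι ι ℝ) :
    Prop where
  smooth : ∀ α β, ContDiffOn ℝ ∞ (fun q => J q α β) U
  symm : ∀ q ∈ U, (g q * J q).IsSymm
  killing : ∃ θ : (ι → ℝ) → ι → ℝ, ∀ q ∈ U, ∀ α β γ,
    covDerivLower g J q α β γ = (1 / 2) * (θ q α * g q β γ + θ q β * g q α γ)

/-- The components `(D_J ρ)(∂_γ, ∂_δ)` of `D_J ρ = d_J ρ + d(tr J) ∧ ρ` for a 1-form `ρ`, where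
`d_J` is the derivation of degree 1 that anticommutes with `d` and has `d_J F = J(dF)`. -/
noncomputable def gaugedD (J : (ι → ℝ) → Matrix ι ι ℝ) (ρ : (ι → ℝ) → ι → ℝ)
    (q : ι → ℝ) (γ δ : ι) : ℝ :=
  (∑ α, (J q α γ * pd α (fun q' => ρ q' δ) q - J q α δ * pd α (fun q' => ρ q' γ) q))
    - (∑ α, ρ q α * (pd γ (fun q' => J q' α δ) q - pd δ (fun q' => J q' α γ) q))
    + (pd γ (fun q' => (J q').trace) q * ρ q δ - pd δ (fun q' => (J q').trace) q * ρ q γ)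

/-- `(g, μ, J)` is a cofactor system on `U`. -/
structure IsCofactorSystem (U : Set (ι → ℝ)) (g : (ι → ℝ) → Matrix ι ι ℝ)
    (μ : (ι → ℝ) → ι → ℝ) (J : (ι → ℝ) → Matrix ι ι ℝ) : Prop where
  metric : IsRiemannianMetric U g
  smooth_force : ∀ α, ContDiffOn ℝ ∞ (fun q => μ q α) U
  scKt : IsSpecialConformalKilling U g J
  nonsingular : ∀ q ∈ U, (J q).det ≠ 0
  closed : ∀ q ∈ U, ∀ γ δ, gaugedD J μ q γ δ = 0

/-- The right-hand sides `f^α(q,v)` of the second-order equations `q̈^α = f^α(q, q̇)` that are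
equivalent to `d/dt (∂T/∂q̇^α) - ∂T/∂q^α = μ_α(q)`, with `T = ½ g_{αβ} q̇^α q̇^β`. -/
noncomputable def sode (g : (ι → ℝ) → Matrix ι ι ℝ) (μ : (ι → ℝ) → ι → ℝ) (α : ι)
    (q v : ι → ℝ) : ℝ :=
  -(∑ β, ∑ γ, christoffel g q α β γ * v β * v γ) + ∑ β, (g q)⁻¹ α β * μ q β

/-- The second-order field `Γ = v^α ∂/∂q^α + f^α ∂/∂v^α` acting on a function. -/
noncomputable def sodeField (f : ι → (ι → ℝ) → (ι → ℝ) → ℝ) (F : (ι → ℝ) → (ι → ℝ) → ℝ)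
    (q v : ι → ℝ) : ℝ :=
  ∑ α, (v α * pdq α F q v + f α q v * pdv α F q v)

/-- Connection coefficients `Γ^α_β = -½ ∂f^α/∂v^β` of a second-order field. -/
noncomputable def conn (f : ι → (ι → ℝ) → (ι → ℝ) → ℝ) (α β : ι) (q v : ι → ℝ) : ℝ :=
  -(1 / 2) * pdv β (f α) q v

/-- Jacobi endomorphism `Φ^α_β = -∂f^α/∂q^β - Γ^α_γ Γ^γ_β - Γ(Γ^α_β)`. -/
noncomputable def jacobiEndo (f : ι → (ι → ℝ) → (ι → ℝ) → ℝ) (q v : ι → ℝ) : Matrix ι ι ℝ :=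
  fun α β => -pdq β (f α) q v - (∑ γ, conn f α γ q v * conn f γ β q v)
    - sodeField f (conn f α β) q v

/-- Dynamical covariant derivative of a vector field along the projection:
`(∇X)^α = Γ(X^α) + Γ^α_β X^β`. -/
noncomputable def dynCov (f : ι → (ι → ℝ) → (ι → ℝ) → ℝ) (X : (ι → ℝ) → (ι → ℝ) → (ι → ℝ))
    (q v : ι → ℝ) : ι → ℝ :=
  fun α => sodeField f (fun q' v' => X q' v' α) q v + ∑ β, conn f α β q v * X q v β

/-- Vertical covariant derivative `(D^V_Z X)^α = Z^β ∂X^α/∂v^β`. -/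
noncomputable def vertCov (Z : ι → ℝ) (X : (ι → ℝ) → (ι → ℝ) → (ι → ℝ))
    (q v : ι → ℝ) : ι → ℝ :=
  fun α => ∑ β, Z β * pdv β (fun q' v' => X q' v' α) q v

/-- `D^H μ (X, Y) = X^β (∂μ_α/∂q^β - V_α(Γ^γ_β) μ_γ) Y^α` for a 1-form `μ` on `U`. -/
noncomputable def horCovForm (f : ι → (ι → ℝ) → (ι → ℝ) → ℝ) (μ : (ι → ℝ) → ι → ℝ)
    (q v X Y : ι → ℝ) : ℝ :=
  ∑ β, ∑ α, X β * (pd β (fun q' => μ q' α) q - ∑ γ, pdv α (conn f γ β) q v * μ q γ) * Y α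

/-- A smooth distribution along the projection `TU → U`: locally spanned by smooth vector fields
along the projection that are pointwise linearly independent. -/
def IsDistributionAlong (U : Set (ι → ℝ))
    (K : (ι → ℝ) → (ι → ℝ) → Submodule ℝ (ι → ℝ)) : Prop :=
  ∃ r : ℕ, ∀ q₀ ∈ U, ∀ v₀, ∃ W : Set ((ι → ℝ) × (ι → ℝ)), IsOpen W ∧ (q₀, v₀) ∈ W ∧
    ∃ X : Fin r → (ι → ℝ) → (ι → ℝ) → (ι → ℝ),
      (∀ k, ContDiffOn ℝ ∞ (fun z : (ι → ℝ) × (ι → ℝ) => X k z.1 z.2) W) ∧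
      ∀ z ∈ W, LinearIndependent ℝ (fun k => X k z.1 z.2) ∧
        Submodule.span ℝ (Set.range fun k => X k z.1 z.2) = K z.1 z.2

/-- `X` is a smooth vector field along the projection with values in `K`. -/
def IsSection (U : Set (ι → ℝ)) (K : (ι → ℝ) → (ι → ℝ) → Submodule ℝ (ι → ℝ))
    (X : (ι → ℝ) → (ι → ℝ) → (ι → ℝ)) : Prop :=
  ContDiffOn ℝ ∞ (fun z : (ι → ℝ) × (ι → ℝ) => X z.1 z.2) (U ×ˢ Set.univ) ∧
    ∀ q ∈ U, ∀ v, X q v ∈ K q v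

/-- `Y` belongs to the `g`-orthogonal complement of `K` at `(q,v)`. -/
def IsOrthogonalTo (g : (ι → ℝ) → Matrix ι ι ℝ)
    (K : (ι → ℝ) → (ι → ℝ) → Submodule ℝ (ι → ℝ)) (q v Y : ι → ℝ) : Prop :=
  ∀ X ∈ K q v, ∑ α, ∑ β, g q α β * Y α * X β = 0

/-- `(g, μ, J)` with the distribution `K` along the projection is a driven cofactor system. -/
structure IsDrivenCofactorSystem (U : Set (ι → ℝ)) (g : (ι → ℝ) → Matrix ι ι ℝ)
    (μ : (ι → ℝ) → ι → ℝ) (J : (ι → ℝ) → Matrix ι ι ℝ)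
    (K : (ι → ℝ) → (ι → ℝ) → Submodule ℝ (ι → ℝ)) : Prop where
  cofactor : IsCofactorSystem U g μ J
  distribution : IsDistributionAlong U K
  jacobi : ∀ X, IsSection U K X → ∀ q ∈ U, ∀ v,
    (jacobiEndo (sode g μ) q v).mulVec (X q v) ∈ K q v
  nabla : ∀ X, IsSection U K X → ∀ q ∈ U, ∀ v, dynCov (sode g μ) X q v ∈ K q v
  vertical : ∀ X, IsSection U K X → ∀ Z, ∀ q ∈ U, ∀ v, vertCov Z X q v ∈ K q v
  closed_on : ∀ q ∈ U, ∀ v, ∀ X ∈ K q v, ∀ Y ∈ K q v,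
    ∑ α, ∑ β, (pd α (fun q' => μ q' β) q - pd β (fun q' => μ q' α) q) * X α * Y β = 0
  coupling : ∃ q ∈ U, ∃ v X Y, IsOrthogonalTo g K q v X ∧ Y ∈ K q v ∧
    horCovForm (sode g μ) μ q v X Y ≠ 0

/-- The coefficient of `a^k` in the cofactor tensor (adjugate) of `J + a P`. -/
noncomputable def cofCoeff (J P : Matrix ι ι ℝ) (k : ℕ) : Matrix ι ι ℝ :=
  fun α β => ((J.map Polynomial.C + (Polynomial.X : Polynomial ℝ) • P.map Polynomial.C).adjugate
    α β).coeff k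

/-- The function `½ B^{αβ} p_α p_β + W`, with `B^{αβ} = B^α_γ g^{γβ}`. -/
noncomputable def quadHam (g B : (ι → ℝ) → Matrix ι ι ℝ) (W : (ι → ℝ) → ℝ)
    (q p : ι → ℝ) : ℝ :=
  (1 / 2) * (∑ α, ∑ β, (B q * (g q)⁻¹) α β * p α * p β) + W q

end General

section Adapted

/-! Adapted coordinates `q = (y, x) = Sum.elim y x` with `y ∈ ℝ^m` and `x ∈ ℝ^n`. -/

variable {m n : ℕ}

/-- The coordinates `(y, x)` are adapted to `K` and `K^⊥` at the same time:
`K = span {∂/∂x^a}` and `K^⊥ = span {∂/∂y^i}`. -/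
def IsAdapted (U : Set (Fin m ⊕ Fin n → ℝ))
    (g : (Fin m ⊕ Fin n → ℝ) → Matrix (Fin m ⊕ Fin n) (Fin m ⊕ Fin n) ℝ)
    (K : (Fin m ⊕ Fin n → ℝ) → (Fin m ⊕ Fin n → ℝ) → Submodule ℝ (Fin m ⊕ Fin n → ℝ)) : Prop :=
  ∀ q ∈ U, ∀ v X : Fin m ⊕ Fin n → ℝ, (X ∈ K q v ↔ ∀ i, X (Sum.inl i) = 0) ∧
    (IsOrthogonalTo g K q v X ↔ ∀ a, X (Sum.inr a) = 0)

/-- The projector `P_2` onto `K` along `K^⊥` in adapted coordinates. -/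
def projK : Matrix (Fin m ⊕ Fin n) (Fin m ⊕ Fin n) ℝ := Matrix.fromBlocks 0 0 0 1

/-- `A_(k)`: the coefficient of `a^(k-1)` in the cofactor tensor of `J + a P_2` (`k ≥ 1`). -/
noncomputable def cofA (J : (Fin m ⊕ Fin n → ℝ) → Matrix (Fin m ⊕ Fin n) (Fin m ⊕ Fin n) ℝ)
    (k : ℕ) (q : Fin m ⊕ Fin n → ℝ) : Matrix (Fin m ⊕ Fin n) (Fin m ⊕ Fin n) ℝ :=
  cofCoeff (J q) projK (k - 1)

/-- `A_(k) μ = -dW` on `U`: the function `W` is a choice of `W_(k)`. -/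
structure IsPotentialW (U : Set (Fin m ⊕ Fin n → ℝ)) (μ : (Fin m ⊕ Fin n → ℝ) → Fin m ⊕ Fin n → ℝ)
    (J : (Fin m ⊕ Fin n → ℝ) → Matrix (Fin m ⊕ Fin n) (Fin m ⊕ Fin n) ℝ) (k : ℕ)
    (W : (Fin m ⊕ Fin n → ℝ) → ℝ) : Prop where
  smooth : ContDiffOn ℝ ∞ W U
  deriv_eq : ∀ q ∈ U, ∀ β, ∑ α, cofA J k q α β * μ q α = -pd β W q

/-- `V(x,y)` is a potential of the driven forces: `μ_a = -∂V/∂x^a`. -/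
structure IsDrivenPotential (U : Set (Fin m ⊕ Fin n → ℝ))
    (μ : (Fin m ⊕ Fin n → ℝ) → Fin m ⊕ Fin n → ℝ) (V : (Fin m ⊕ Fin n → ℝ) → ℝ) : Prop where
  smooth : ContDiffOn ℝ ∞ V U
  deriv_eq : ∀ q ∈ U, ∀ a, μ q (Sum.inr a) = -pd (Sum.inr a) V q

/-- The functions `ψ^i(x,y)` satisfy `J^i_a = ∂ψ^i/∂x^a`. -/
structure IsPsi (U : Set (Fin m ⊕ Fin n → ℝ))
    (J : (Fin m ⊕ Fin n → ℝ) → Matrix (Fin m ⊕ Fin n) (Fin m ⊕ Fin n) ℝ)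
    (ψ : Fin m → (Fin m ⊕ Fin n → ℝ) → ℝ) : Prop where
  smooth : ∀ i, ContDiffOn ℝ ∞ (ψ i) U
  deriv_eq : ∀ q ∈ U, ∀ i a, J q (Sum.inl i) (Sum.inr a) = pd (Sum.inr a) (ψ i) q

/-- `y(t)`, `t ∈ I`, solves the driving equations `ÿ^i = f^i(y, ẏ)`, and `ptil` are the
corresponding modified momenta, `g_{ij} ẏ^j = p_i = J^j_i ptil_j`. For a driven cofactor system in
adapted coordinates with connected `x`-slices, neither `f^i` nor `g_{ij}` and `J^i_j` depend on
the driven coordinates `x` and velocities `w`, so that it is immaterial at which `x` and `w` they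
are evaluated. -/
def IsDrivingSolution (U : Set (Fin m ⊕ Fin n → ℝ))
    (g : (Fin m ⊕ Fin n → ℝ) → Matrix (Fin m ⊕ Fin n) (Fin m ⊕ Fin n) ℝ)
    (μ : (Fin m ⊕ Fin n → ℝ) → Fin m ⊕ Fin n → ℝ)
    (J : (Fin m ⊕ Fin n → ℝ) → Matrix (Fin m ⊕ Fin n) (Fin m ⊕ Fin n) ℝ)
    (I : Set ℝ) (y ptil : ℝ → Fin m → ℝ) : Prop :=
  ∃ ydot : ℝ → Fin m → ℝ, ∀ t ∈ I, (∀ i, HasDerivAt (fun s => y s i) (ydot t i) t) ∧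
    ∃ x w : Fin n → ℝ, Sum.elim (y t) x ∈ U ∧
      (∀ i, HasDerivAt (fun s => ydot s i)
        (sode g μ (Sum.inl i) (Sum.elim (y t) x) (Sum.elim (ydot t) w)) t) ∧
      ∀ i, ∑ j, g (Sum.elim (y t) x) (Sum.inl i) (Sum.inl j) * ydot t j =
        ∑ j, J (Sum.elim (y t) x) (Sum.inl j) (Sum.inl i) * ptil t j

/-- The Hamiltonian `h(x,p,t) = ½ g^{ab} p_a p_b + V(x,y(t))` of the driven system along `y(t)`. -/
noncomputable def drivenHam
    (g : (Fin m ⊕ Fin n → ℝ) → Matrix (Fin m ⊕ Fin n) (Fin m ⊕ Fin n) ℝ)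
    (V : (Fin m ⊕ Fin n → ℝ) → ℝ) (y : ℝ → Fin m → ℝ) (x p : Fin n → ℝ) (t : ℝ) : ℝ :=
  (1 / 2) * (∑ a, ∑ b, (g (Sum.elim (y t) x))⁻¹ (Sum.inr a) (Sum.inr b) * p a * p b)
    + V (Sum.elim (y t) x)

/-- The generating function `F(x,P,t) = x^a P_a + ψ^i(x,y(t)) ptil_i(t)`. -/
noncomputable def genF (ψ : Fin m → (Fin m ⊕ Fin n → ℝ) → ℝ) (y ptil : ℝ → Fin m → ℝ)
    (x P : Fin n → ℝ) (t : ℝ) : ℝ :=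
  ∑ a, x a * P a + ∑ i, ψ i (Sum.elim (y t) x) * ptil t i

/-- The old momenta `(p_i, p_a)` in terms of the new ones at `q`:
`p_i = J^j_i ptil_j`, `p_a = P_a + J^i_a ptil_i`. -/
noncomputable def oldMomenta (J : Matrix (Fin m ⊕ Fin n) (Fin m ⊕ Fin n) ℝ)
    (pt : Fin m → ℝ) (P : Fin n → ℝ) : Fin m ⊕ Fin n → ℝ :=
  Sum.elim (fun i => ∑ j, J (Sum.inl j) (Sum.inl i) * pt j)
    (fun a => P a + ∑ i, J (Sum.inl i) (Sum.inr a) * pt i)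

end Adapted

section Canonical

variable {n : ℕ}

/-- At time `t`, the transformation generated by `F(x,P,t)` (old positions, new momenta) relates
`(x,p)` to `(X,P)`: `p_a = ∂F/∂x^a` and `X^a = ∂F/∂P_a`. -/
def GenRel (F : (Fin n → ℝ) → (Fin n → ℝ) → ℝ → ℝ) (t : ℝ) (x p X P : Fin n → ℝ) : Prop :=
  (∀ a, HasDerivAt (fun s => F (Function.update x a s) P t) (p a) (x a)) ∧
    ∀ a, HasDerivAt (fun s => F x (Function.update P a s) t) (X a) (P a)

/-- `k'(X,P,t)` is the transform of the Hamiltonian `k(x,p,t)` under the time-dependent canonical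
transformation generated by `F`, over the set `D` of pairs `(t,x)`: the partial derivative `∂F/∂t`
exists and `k' = k + ∂F/∂t` at corresponding points. -/
def IsTransformedHam (F : (Fin n → ℝ) → (Fin n → ℝ) → ℝ → ℝ) (D : Set (ℝ × (Fin n → ℝ)))
    (k k' : (Fin n → ℝ) → (Fin n → ℝ) → ℝ → ℝ) : Prop :=
  ∀ t x p X P, (t, x) ∈ D → GenRel F t x p X P →
    ∃ e, HasDerivAt (fun s => F x P s) e t ∧ k' X P t = k x p t + e

end Canonical

end DrivenCofactor

open DrivenCofactor

/-! Write `J` in blocks `J1`, `B`, `D`, `J2`, so that `B` has the entries `J^i_a` and `D` the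
entries `J^a_i`. The claim is that `h + ∂F/∂t - (det J1)⁻¹ H_(n) - J^{ai} P_a ptil_i`, at
corresponding points, depends on time alone.

Dependence on the momenta is removed by algebra. The pencil `J + a P_2` differs from `J` by `a`
times the identity in the driven block, so `A_(n)` can be computed from the Schur complement of `J1`
(`cofCoeff_projK`): its driven block is `det J1` times the identity. Hence the terms quadratic in
`P` agree with those of `h`. The linear ones balance because `gJ` is symmetric and the term `J^{ai}
P_a ptil_i` has been added (`kinetic_identity`). What survives is `residual`, a function of `(y(t),
x)`.

Dependence on `x` is removed by geometry. Invariance of `K` under `∇`, together with orthogonality,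
makes `g` a product metric `g_ij(y)`, `g_ab(x)`; the Killing equation then makes `J1` a function of
`y` only, and invariance under `Φ` does the same for the driving forces. The Killing equation with
1-form `θ = d(tr J)` also gives the `x`-derivatives of `tr J`, of `B D` and, through mixed partial
derivatives, of `∂ψ^i/∂y^j`. The derivative of `ptil` comes from differentiating `p_i = J^j_i
ptil_j` along the motion (`modified_momenta_identity`). With these, the `x`-derivatives of the
residual cancel identically (`energy_cancellation`), and connectedness of the slice makes the
residual a function `c(t)`. -/

namespace DrivenCofactor

/-! ### The cofactor tensor of the pencil `J + a P_2`. -/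

section Cofactor

open Matrix Polynomial

variable {m n : ℕ}

/-- The matrix `J + a P_2` over `ℝ[a]`. -/
noncomputable def pencil (J : Matrix (Fin m ⊕ Fin n) (Fin m ⊕ Fin n) ℝ) :
    Matrix (Fin m ⊕ Fin n) (Fin m ⊕ Fin n) ℝ[X] :=
  J.map C + (X : ℝ[X]) • (projK (m := m) (n := n)).map C

/-- Since `det J1` is a nonzero constant, `J1` stays invertible over `ℝ[a]`. The Schur complement of
`J1` in the pencil is `a + J2 - D J1⁻¹ B`, whose determinant is a characteristic polynomial in `a`.
-/
lemma det_pencil (J1 : Matrix (Fin m) (Fin m) ℝ) (B : Matrix (Fin m) (Fin n) ℝ)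
    (D : Matrix (Fin n) (Fin m) ℝ) (J2 : Matrix (Fin n) (Fin n) ℝ) (h : J1.det ≠ 0) :
    (pencil (fromBlocks J1 B D J2)).det = C J1.det * (-(J2 - D * J1⁻¹ * B)).charpoly := by
  have hu : IsUnit J1.det := isUnit_iff_ne_zero.mpr h
  have h1 : (J1⁻¹).map C * J1.map C = (1 : Matrix (Fin m) (Fin m) ℝ[X]) := by
    rw [← Matrix.map_mul, Matrix.nonsing_inv_mul _ hu]
    exact Matrix.map_one _ (map_zero _) (map_one _)
  have h2 : J1.map C * (J1⁻¹).map C = (1 : Matrix (Fin m) (Fin m) ℝ[X]) := by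
    rw [← Matrix.map_mul, Matrix.mul_nonsing_inv _ hu]
    exact Matrix.map_one _ (map_zero _) (map_one _)
  let inv : Invertible (J1.map (C : ℝ →+* ℝ[X])) := ⟨(J1⁻¹).map C, h1, h2⟩
  have hM : pencil (fromBlocks J1 B D J2) =
      fromBlocks (J1.map C) (B.map C) (D.map C) (J2.map C + scalar (Fin n) (X : ℝ[X])) := by
    ext (i | a) (j | b)
    · simp [pencil, projK]
    · simp [pencil, projK]
    · simp [pencil, projK]
    · simp only [pencil, projK, Matrix.add_apply, Matrix.smul_apply, Matrix.map_apply,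
        fromBlocks_apply₂₂, smul_eq_mul, scalar_apply, Matrix.diagonal_apply, Matrix.one_apply]
      split_ifs <;> simp
  have hinv : ⅟(J1.map (C : ℝ →+* ℝ[X])) = (J1⁻¹).map C := rfl
  rw [hM, det_fromBlocks₁₁, hinv]
  congr 1
  · exact (RingHom.map_det C J1).symm
  · rw [Matrix.charpoly, charmatrix]
    congr 1
    rw [← Matrix.map_mul, ← Matrix.map_mul]
    ext1 a b
    simp only [Matrix.sub_apply, Matrix.add_apply, RingHom.mapMatrix_apply, Matrix.map_apply,
      Matrix.neg_apply, map_neg, map_sub]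
    ring

/-- The characteristic polynomial is monic of degree `n`, and its next coefficient is minus the
trace; the sign is undone by the minus in `det_pencil`. -/
lemma coeff_det_pencil (J1 : Matrix (Fin m) (Fin m) ℝ) (B : Matrix (Fin m) (Fin n) ℝ)
    (D : Matrix (Fin n) (Fin m) ℝ) (J2 : Matrix (Fin n) (Fin n) ℝ) (h : J1.det ≠ 0) (hn : 0 < n) :
    (∀ k, n < k → (pencil (fromBlocks J1 B D J2)).det.coeff k = 0) ∧
    (pencil (fromBlocks J1 B D J2)).det.coeff n = J1.det ∧
    (pencil (fromBlocks J1 B D J2)).det.coeff (n - 1) =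
      J1.det * (J2 - D * J1⁻¹ * B).trace := by
  have : Nonempty (Fin n) := ⟨⟨0, hn⟩⟩
  have hdeg := charpoly_natDegree_eq_dim (-(J2 - D * J1⁻¹ * B))
  rw [Fintype.card_fin] at hdeg
  refine ⟨fun k hk => ?_, ?_, ?_⟩
  · rw [det_pencil _ _ _ _ h, coeff_C_mul, coeff_eq_zero_of_natDegree_lt (by omega), mul_zero]
  · have := (charpoly_monic (-(J2 - D * J1⁻¹ * B))).coeff_natDegree
    rw [hdeg] at this
    rw [det_pencil _ _ _ _ h, coeff_C_mul, this, mul_one]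
  · have := trace_eq_neg_charpoly_coeff (-(J2 - D * J1⁻¹ * B))
    rw [Fintype.card_fin, Matrix.trace_neg] at this
    rw [det_pencil _ _ _ _ h, coeff_C_mul]
    congr 1
    linarith

/-- Coefficients of `a^k` are compared in `(J + a P_2) adj = det · 1`. The driving rows of `P_2`
vanish, so these rows of the identity do not mix different orders in `a`. -/
lemma mul_cofCoeff_inl (J : Matrix (Fin m ⊕ Fin n) (Fin m ⊕ Fin n) ℝ) (k : ℕ) (i : Fin m)
    (β : Fin m ⊕ Fin n) : (J * cofCoeff J projK k) (Sum.inl i) β =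
      (pencil J).det.coeff k * (1 : Matrix (Fin m ⊕ Fin n) (Fin m ⊕ Fin n) ℝ) (Sum.inl i) β := by
  have h := congrArg (fun Z => (Z (Sum.inl i) β).coeff k) (mul_adjugate (pencil J))
  simp only [Matrix.mul_apply, Matrix.smul_apply, smul_eq_mul, finsetSum_coeff] at h
  have h1 : ∀ γ, (pencil J (Sum.inl i) γ * (pencil J).adjugate γ β).coeff k =
      J (Sum.inl i) γ * cofCoeff J projK k γ β := by
    intro γ
    have : pencil J (Sum.inl i) γ = C (J (Sum.inl i) γ) := by
      rcases γ with j | b <;> simp [pencil, projK]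
    rw [this, coeff_C_mul]
    rfl
  simp only [h1] at h
  rw [Matrix.mul_apply, h]
  rcases eq_or_ne (Sum.inl i) β with rfl | hne
  · simp
  · simp [Matrix.one_apply_ne hne]

/-- In the driven rows `a P_2` shifts the order by one. This yields a recursion that goes down from
order `k + 1` to order `k`. -/
lemma mul_cofCoeff_inr (J : Matrix (Fin m ⊕ Fin n) (Fin m ⊕ Fin n) ℝ) (k : ℕ) (a : Fin n)
    (β : Fin m ⊕ Fin n) : (J * cofCoeff J projK (k + 1)) (Sum.inr a) β +
      cofCoeff J projK k (Sum.inr a) β = (pencil J).det.coeff (k + 1) *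
        (1 : Matrix (Fin m ⊕ Fin n) (Fin m ⊕ Fin n) ℝ) (Sum.inr a) β := by
  have h := congrArg (fun Z => (Z (Sum.inr a) β).coeff (k + 1)) (mul_adjugate (pencil J))
  simp only [Matrix.mul_apply, Matrix.smul_apply, smul_eq_mul, finsetSum_coeff] at h
  have h1 : ∀ γ, (pencil J (Sum.inr a) γ * (pencil J).adjugate γ β).coeff (k + 1) =
      J (Sum.inr a) γ * cofCoeff J projK (k + 1) γ β +
        projK (Sum.inr a) γ * cofCoeff J projK k γ β := by
    intro γ
    have : pencil J (Sum.inr a) γ = C (J (Sum.inr a) γ) + X * C (projK (Sum.inr a) γ) := by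
      simp [pencil]
    rw [this, add_mul, coeff_add, coeff_C_mul, mul_assoc, coeff_X_mul, coeff_C_mul]
    rfl
  simp only [h1, Finset.sum_add_distrib] at h
  have h2 : ∑ γ, projK (Sum.inr a) γ * cofCoeff J projK k γ β =
      cofCoeff J projK k (Sum.inr a) β := by
    simp [projK, Fintype.sum_sum_type, Matrix.one_apply]
  rw [h2] at h
  rw [Matrix.mul_apply, h]
  rcases eq_or_ne (Sum.inr a) β with rfl | hne
  · simp
  · simp [Matrix.one_apply_ne hne]

lemma exists_cofCoeff_eq_zero (J P : Matrix (Fin m ⊕ Fin n) (Fin m ⊕ Fin n) ℝ) :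
    ∃ N, ∀ k, N ≤ k → cofCoeff J P k = 0 := by
  refine ⟨(∑ α, ∑ β, ((J.map C + (X : ℝ[X]) • P.map C).adjugate α β).natDegree) + 1,
    fun k hk => ?_⟩
  ext α β
  refine coeff_eq_zero_of_natDegree_lt (lt_of_le_of_lt ?_ hk)
  refine le_trans ?_ (Finset.single_le_sum (fun _ _ => Nat.zero_le _) (Finset.mem_univ α))
  exact Finset.single_le_sum
    (f := fun β => ((J.map C + (X : ℝ[X]) • P.map C).adjugate α β).natDegree)
    (fun _ _ => Nat.zero_le _) (Finset.mem_univ β)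

/-- The cofactor tensor of `J + a P_2`, in blocks, at the order `a^(n-1)`. -/
lemma cofCoeff_projK (J1 : Matrix (Fin m) (Fin m) ℝ) (B : Matrix (Fin m) (Fin n) ℝ)
    (D : Matrix (Fin n) (Fin m) ℝ) (J2 : Matrix (Fin n) (Fin n) ℝ) (h : J1.det ≠ 0) (hn : 0 < n) :
    cofCoeff (fromBlocks J1 B D J2) projK (n - 1) = J1.det • fromBlocks
      ((J2 - D * J1⁻¹ * B).trace • J1⁻¹ + J1⁻¹ * B * D * J1⁻¹) (-(J1⁻¹ * B)) (-(D * J1⁻¹)) 1 := by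
  obtain ⟨hd1, hd2, hd3⟩ := coeff_det_pencil J1 B D J2 h hn
  have hu : IsUnit J1.det := isUnit_iff_ne_zero.mpr h
  set J := fromBlocks J1 B D J2 with hJ
  set Z := cofCoeff J (projK (m := m) (n := n)) with hZ
  have z11 : (0 : Matrix (Fin m ⊕ Fin n) (Fin m ⊕ Fin n) ℝ).toBlocks₁₁ = 0 := rfl
  have z12 : (0 : Matrix (Fin m ⊕ Fin n) (Fin m ⊕ Fin n) ℝ).toBlocks₁₂ = 0 := rfl
  have z21 : (0 : Matrix (Fin m ⊕ Fin n) (Fin m ⊕ Fin n) ℝ).toBlocks₂₁ = 0 := rfl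
  have z22 : (0 : Matrix (Fin m ⊕ Fin n) (Fin m ⊕ Fin n) ℝ).toBlocks₂₂ = 0 := rfl
  have top1 : ∀ k, J1 * (Z k).toBlocks₁₁ + B * (Z k).toBlocks₂₁ = (pencil J).det.coeff k • 1 := by
    intro k; ext i j
    have := mul_cofCoeff_inl J k i (Sum.inl j)
    rw [← hZ, Matrix.mul_apply, Fintype.sum_sum_type] at this
    simpa [hJ, Matrix.mul_apply, toBlocks₁₁, toBlocks₂₁, Matrix.one_apply] using this
  have top2 : ∀ k, J1 * (Z k).toBlocks₁₂ + B * (Z k).toBlocks₂₂ = 0 := by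
    intro k; ext i j
    have := mul_cofCoeff_inl J k i (Sum.inr j)
    rw [← hZ, Matrix.mul_apply, Fintype.sum_sum_type] at this
    simpa [hJ, Matrix.mul_apply, toBlocks₁₂, toBlocks₂₂, Matrix.one_apply] using this
  have bot1 : ∀ k, D * (Z (k + 1)).toBlocks₁₁ + J2 * (Z (k + 1)).toBlocks₂₁ +
      (Z k).toBlocks₂₁ = 0 := by
    intro k; ext i j
    have := mul_cofCoeff_inr J k i (Sum.inl j)
    rw [← hZ, Matrix.mul_apply, Fintype.sum_sum_type] at this
    simpa [hJ, Matrix.mul_apply, toBlocks₁₁, toBlocks₂₁, Matrix.one_apply] using this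
  have bot2 : ∀ k, D * (Z (k + 1)).toBlocks₁₂ + J2 * (Z (k + 1)).toBlocks₂₂ +
      (Z k).toBlocks₂₂ = (pencil J).det.coeff (k + 1) • 1 := by
    intro k; ext i j
    have := mul_cofCoeff_inr J k i (Sum.inr j)
    rw [← hZ, Matrix.mul_apply, Fintype.sum_sum_type] at this
    simpa [hJ, Matrix.mul_apply, toBlocks₁₂, toBlocks₂₂, Matrix.one_apply] using this
  have cancel : ∀ {l : ℕ} {M N : Matrix (Fin m) (Fin l) ℝ}, J1 * M = N → M = J1⁻¹ * N := by
    intro l M N hMN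
    rw [← hMN, ← Matrix.mul_assoc, Matrix.nonsing_inv_mul _ hu, Matrix.one_mul]
  obtain ⟨N, hN⟩ := exists_cofCoeff_eq_zero J (projK (m := m) (n := n))
  -- Descending induction from a degree bound: the driven rows give the lower blocks of `Z k` from
  -- `Z (k + 1)`, then the driving rows give the upper blocks because `J1` is invertible. The same
  -- two moves at `n` and `n - 1` give the formula.
  have hvan : ∀ k, n < k → Z k = 0 := by
    have key : ∀ d k, N ≤ k + d → n < k → Z k = 0 := by
      intro d
      induction d with
      | zero => exact fun k hk _ => hN k hk
      | succ d ih =>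
        intro k hk hnk
        have h0 := ih (k + 1) (by omega) (by omega)
        have b1 := bot1 k
        have b2 := bot2 k
        rw [h0, hd1 _ (by omega)] at b2
        rw [h0] at b1
        have e21 : (Z k).toBlocks₂₁ = 0 := by simpa [z11, z21] using b1
        have e22 : (Z k).toBlocks₂₂ = 0 := by simpa [z12, z22] using b2
        have t1 := top1 k
        have t2 := top2 k
        rw [e21, hd1 _ hnk, Matrix.mul_zero, add_zero, zero_smul] at t1
        rw [e22, Matrix.mul_zero, add_zero] at t2
        rw [← fromBlocks_toBlocks (Z k), e21, e22, cancel t1, cancel t2]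
        simp
    exact fun k hk => key N k (by omega) hk
  have hZn1 := hvan (n + 1) (by omega)
  have e21 : (Z n).toBlocks₂₁ = 0 := by
    have := bot1 n
    rw [hZn1] at this
    simpa [z11, z21] using this
  have e22 : (Z n).toBlocks₂₂ = 0 := by
    have := bot2 n
    rw [hZn1, hd1 _ (by omega)] at this
    simpa [z12, z22] using this
  have e11 : (Z n).toBlocks₁₁ = J1⁻¹ * (J1.det • 1) := by
    have := top1 n
    rw [e21, hd2, Matrix.mul_zero, add_zero] at this
    exact cancel this
  have e12 : (Z n).toBlocks₁₂ = 0 := by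
    have := top2 n
    rw [e22, Matrix.mul_zero, add_zero] at this
    rw [cancel this, Matrix.mul_zero]
  -- Natural subtraction: this is where `0 < n` matters.
  have hn1 : n - 1 + 1 = n := by omega
  have f21 : (Z (n - 1)).toBlocks₂₁ = J1.det • -(D * J1⁻¹) := by
    have := bot1 (n - 1)
    rw [hn1, e21, e11, Matrix.mul_zero, add_zero] at this
    rw [eq_neg_of_add_eq_zero_right this]
    simp
  have f22 : (Z (n - 1)).toBlocks₂₂ = J1.det • 1 := by
    have := bot2 (n - 1)
    rw [hn1, e22, e12, hd2, Matrix.mul_zero, Matrix.mul_zero, add_zero, zero_add] at this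
    exact this
  have f11 := cancel (eq_sub_of_add_eq (top1 (n - 1)))
  have f12 := cancel (eq_sub_of_add_eq (top2 (n - 1)))
  rw [← fromBlocks_toBlocks (Z (n - 1)), f11, f12, f21, f22, hd3, fromBlocks_smul]
  congr 1
  · simp only [Matrix.mul_smul, Matrix.mul_neg, smul_neg, sub_neg_eq_add, Matrix.mul_add,
      Matrix.mul_one, smul_add, smul_smul, Matrix.mul_assoc]
  · simp

end Cofactor

/-! ### The matrix identities behind the cancellation, free of calculus. -/

section Cancellation

open Matrix

variable {m n : ℕ}

/-- The kinetic part of `(det J_1)⁻¹ H_(n) + J^{ai} P_a ptil_i`. -/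
lemma kinetic_identity (J1 g1 : Matrix (Fin m) (Fin m) ℝ) (B : Matrix (Fin m) (Fin n) ℝ)
    (D : Matrix (Fin n) (Fin m) ℝ) (g2 : Matrix (Fin n) (Fin n) ℝ) (hJ : J1.det ≠ 0)
    (hg1 : g1.det ≠ 0) (hg2 : g2.det ≠ 0) (s1 : g1ᵀ = g1) (s2 : g2ᵀ = g2)
    (sJ : (g1 * J1)ᵀ = g1 * J1) (sB : (g1 * B)ᵀ = g2 * D) (τ : ℝ) (pt v : Fin m → ℝ)
    (P : Fin n → ℝ) (hv : g1 *ᵥ v = J1ᵀ *ᵥ pt) :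
    (1 / 2) * (Sum.elim (J1ᵀ *ᵥ pt) (P + Bᵀ *ᵥ pt) ⬝ᵥ
      ((fromBlocks (τ • J1⁻¹ + J1⁻¹ * B * D * J1⁻¹) (-(J1⁻¹ * B)) (-(D * J1⁻¹)) 1 *
        fromBlocks g1⁻¹ 0 0 g2⁻¹) *ᵥ Sum.elim (J1ᵀ *ᵥ pt) (P + Bᵀ *ᵥ pt))) +
      P ⬝ᵥ ((D * g1⁻¹) *ᵥ pt) =
    (1 / 2) * ((P + Bᵀ *ᵥ pt) ⬝ᵥ (g2⁻¹ *ᵥ (P + Bᵀ *ᵥ pt))) + (1 / 2) * τ * (pt ⬝ᵥ v) -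
      (1 / 2) * (pt ⬝ᵥ ((B * D) *ᵥ (g1⁻¹ *ᵥ pt))) := by
  have huJ : IsUnit J1.det := isUnit_iff_ne_zero.mpr hJ
  have hu1 : IsUnit g1.det := isUnit_iff_ne_zero.mpr hg1
  have hu2 : IsUnit g2.det := isUnit_iff_ne_zero.mpr hg2
  -- Symmetry of `J` with both indices raised, in the mixed block; `eJ` below uses the driving
  -- block.
  have eB : B * g2⁻¹ = g1⁻¹ * Dᵀ := by
    have h0 : g1 * B = Dᵀ * g2 := by
      have := congrArg Matrix.transpose sB
      rwa [Matrix.transpose_transpose, Matrix.transpose_mul, s2] at this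
    calc B * g2⁻¹ = g1⁻¹ * (g1 * B) * g2⁻¹ := by
          rw [← Matrix.mul_assoc, Matrix.nonsing_inv_mul _ hu1, Matrix.one_mul]
      _ = g1⁻¹ * Dᵀ := by
          rw [h0, Matrix.mul_assoc, Matrix.mul_assoc, Matrix.mul_nonsing_inv _ hu2, Matrix.mul_one]
  have ev : g1⁻¹ *ᵥ (J1ᵀ *ᵥ pt) = v := by
    rw [← hv, Matrix.mulVec_mulVec, Matrix.nonsing_inv_mul _ hu1, Matrix.one_mulVec]
  have eJ : J1⁻¹ *ᵥ v = g1⁻¹ *ᵥ pt := by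
    have h0 : J1 * g1⁻¹ = g1⁻¹ * J1ᵀ := by
      calc J1 * g1⁻¹ = g1⁻¹ * (g1 * J1) * g1⁻¹ := by
            rw [← Matrix.mul_assoc, Matrix.nonsing_inv_mul _ hu1, Matrix.one_mul]
        _ = g1⁻¹ * J1ᵀ := by
            rw [← sJ, Matrix.transpose_mul, s1, Matrix.mul_assoc, Matrix.mul_assoc,
              Matrix.mul_nonsing_inv _ hu1, Matrix.mul_one]
    rw [← ev, Matrix.mulVec_mulVec _ g1⁻¹, ← h0, Matrix.mulVec_mulVec, ← Matrix.mul_assoc,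
      Matrix.nonsing_inv_mul _ huJ, Matrix.one_mul]
  set w := g1⁻¹ *ᵥ pt with hw
  set px := P + Bᵀ *ᵥ pt with hpx
  have dotJ : ∀ z, (J1ᵀ *ᵥ pt) ⬝ᵥ (J1⁻¹ *ᵥ z) = pt ⬝ᵥ z := by
    intro z
    rw [Matrix.dotProduct_mulVec, Matrix.mulVec_transpose, Matrix.vecMul_vecMul,
      Matrix.mul_nonsing_inv _ huJ, Matrix.vecMul_one]
  -- The two off-diagonal blocks of `A_(n)` contribute equally, in total `-px ⬝ᵥ (D *ᵥ w)`. By `e2`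
  -- its `P`-part is removed by the added cross term, and the rest is quadratic in `pt`.
  have e1 : pt ⬝ᵥ (B *ᵥ (g2⁻¹ *ᵥ px)) = px ⬝ᵥ (D *ᵥ w) := by
    have s1' : (g1⁻¹)ᵀ = g1⁻¹ := by rw [Matrix.transpose_nonsing_inv, s1]
    rw [Matrix.mulVec_mulVec, eB, Matrix.dotProduct_mulVec, ← Matrix.vecMul_vecMul,
      ← Matrix.mulVec_transpose g1⁻¹, s1', Matrix.vecMul_transpose, dotProduct_comm]
  have e2 : px ⬝ᵥ (D *ᵥ w) = P ⬝ᵥ (D *ᵥ w) + pt ⬝ᵥ (B *ᵥ (D *ᵥ w)) := by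
    rw [hpx, add_dotProduct, Matrix.mulVec_transpose, ← Matrix.dotProduct_mulVec]
  rw [Matrix.fromBlocks_multiply, Matrix.fromBlocks_mulVec, sumElim_dotProduct_sumElim]
  simp only [Sum.elim_comp_inl, Sum.elim_comp_inr, Matrix.mul_zero, add_zero, zero_add,
    ← Matrix.mulVec_mulVec, ev, dotProduct_add, Matrix.add_mulVec, Matrix.smul_mulVec,
    Matrix.neg_mulVec, dotProduct_neg, dotProduct_smul, eJ, dotJ, Matrix.one_mulVec,
    smul_eq_mul, e1, ← hw]
  have e3 : (J1ᵀ *ᵥ pt) ⬝ᵥ w = pt ⬝ᵥ v := by rw [← eJ, dotJ]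
  rw [e3, e2]
  ring

/-- The evolution of the modified momenta, from the covariant derivatives along the curve. -/
lemma modified_momenta_identity (M g1 G dM dg : Matrix (Fin m) (Fin m) ℝ)
    (θ θs μ1 v acc pt pt' : Fin m → ℝ)
    (hp : g1 *ᵥ v = Mᵀ *ᵥ pt)
    (hacc : g1 *ᵥ acc = μ1 - g1 *ᵥ (G *ᵥ v))
    (hdg : dg = g1 * G + Gᵀ * g1)
    (hdM : dM = M * G - G * M + (1 / 2 : ℝ) • (vecMulVec θs (g1 *ᵥ v) + vecMulVec v θ))
    (hdiff : dg *ᵥ v + g1 *ᵥ acc = dMᵀ *ᵥ pt + Mᵀ *ᵥ pt') :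
    Mᵀ *ᵥ pt' = μ1 + Mᵀ *ᵥ (Gᵀ *ᵥ pt) -
      (1 / 2 : ℝ) • ((θs ⬝ᵥ pt) • (g1 *ᵥ v) + (v ⬝ᵥ pt) • θ) := by
  have h : Mᵀ *ᵥ pt' = dg *ᵥ v + g1 *ᵥ acc - dMᵀ *ᵥ pt := by
    rw [hdiff, add_sub_cancel_left]
  rw [h, hacc, hdg, hdM]
  -- The two `g1 G v` terms cancel, and so does `Gᵀ g1 v` against `Gᵀ Mᵀ pt` by `hp`; only `Mᵀ Gᵀ
  -- pt` remains of the connection.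
  simp only [Matrix.transpose_add, Matrix.transpose_sub, Matrix.transpose_mul,
    Matrix.transpose_smul, Matrix.transpose_vecMulVec, Matrix.add_mulVec, Matrix.sub_mulVec,
    Matrix.smul_mulVec, vecMulVec_mulVec, ← Matrix.mulVec_mulVec, hp, op_smul_eq_smul]
  abel

/-- The cancellation that makes `h + ∂F/∂t - (det J_1)⁻¹ H_(n) - J^{ai} P_a ptil_i` independent of
the driven coordinates. -/
lemma energy_cancellation (M g1 G dBD : Matrix (Fin m) (Fin m) ℝ)
    (θ θs μ1 v b pt pt' r : Fin m → ℝ) (θb : ℝ) (hM : M.det ≠ 0)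
    (sJ : (g1 * M)ᵀ = g1 * M) (s1 : g1ᵀ = g1)
    (hθs : g1 *ᵥ θs = θ) (hr : g1 *ᵥ r = pt) (hp : g1 *ᵥ v = Mᵀ *ᵥ pt)
    (hpt' : Mᵀ *ᵥ pt' = μ1 + Mᵀ *ᵥ (Gᵀ *ᵥ pt) -
      (1 / 2 : ℝ) • ((θs ⬝ᵥ pt) • (g1 *ᵥ v) + (v ⬝ᵥ pt) • θ))
    (hdBD : dBD = (1 / 2 : ℝ) • (vecMulVec θs (g1 *ᵥ b) + vecMulVec b θ)) :
    -(μ1 ⬝ᵥ (M⁻¹ *ᵥ b)) + (-((G *ᵥ b) ⬝ᵥ pt) + (1 / 2) * θb * (v ⬝ᵥ pt)) + b ⬝ᵥ pt' -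
      (1 / 2) * (θb - (M⁻¹ * dBD).trace) * (v ⬝ᵥ pt) + (1 / 2) * (pt ⬝ᵥ (dBD *ᵥ r)) = 0 := by
  have huM : IsUnit M.det := isUnit_iff_ne_zero.mpr hM
  -- The derivative `pt'` is known only through `Mᵀ *ᵥ pt'`. Writing `b = M u` lets `M` move over to
  -- it.
  obtain ⟨u, rfl⟩ : ∃ u, b = M *ᵥ u := ⟨M⁻¹ *ᵥ b, by
    rw [Matrix.mulVec_mulVec, Matrix.mul_nonsing_inv _ huM, Matrix.one_mulVec]⟩
  have hMu : M⁻¹ *ᵥ (M *ᵥ u) = u := by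
    rw [Matrix.mulVec_mulVec, Matrix.nonsing_inv_mul _ huM, Matrix.one_mulVec]
  have adj : ∀ (A : Matrix (Fin m) (Fin m) ℝ) (x z : Fin m → ℝ),
      (A *ᵥ x) ⬝ᵥ z = x ⬝ᵥ (Aᵀ *ᵥ z) := by
    intro A x z
    rw [Matrix.dotProduct_mulVec, Matrix.vecMul_transpose]
  have e1 : (M *ᵥ u) ⬝ᵥ pt' = u ⬝ᵥ μ1 + (G *ᵥ (M *ᵥ u)) ⬝ᵥ pt -
      (1 / 2) * ((θs ⬝ᵥ pt) * ((M *ᵥ u) ⬝ᵥ pt) + (v ⬝ᵥ pt) * (u ⬝ᵥ θ)) := by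
    rw [adj, hpt', hp]
    simp only [dotProduct_sub, dotProduct_add, dotProduct_smul, smul_eq_mul]
    rw [adj G, adj M, adj M]
  -- Each of the two rank-one terms of `dBD` contributes half, by the symmetry of `g1 * M`.
  have e2 : (M⁻¹ * dBD).trace = u ⬝ᵥ θ := by
    have h1 : (M⁻¹ *ᵥ θs) ⬝ᵥ (g1 *ᵥ (M *ᵥ u)) = u ⬝ᵥ θ := by
      rw [dotProduct_comm, Matrix.mulVec_mulVec _ g1, adj, sJ, ← Matrix.mulVec_mulVec,
        Matrix.mulVec_mulVec _ M, Matrix.mul_nonsing_inv _ huM, Matrix.one_mulVec, hθs]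
    rw [hdBD, Matrix.mul_smul, Matrix.mul_add, Matrix.mul_vecMulVec, Matrix.mul_vecMulVec,
      Matrix.trace_smul, Matrix.trace_add, trace_vecMulVec, trace_vecMulVec, hMu, h1, smul_eq_mul]
    ring
  have e3 : pt ⬝ᵥ (dBD *ᵥ r) = (θs ⬝ᵥ pt) * ((M *ᵥ u) ⬝ᵥ pt) := by
    have h1 : (g1 *ᵥ (M *ᵥ u)) ⬝ᵥ r = (M *ᵥ u) ⬝ᵥ pt := by rw [adj, s1, hr]
    have h2 : θ ⬝ᵥ r = θs ⬝ᵥ pt := by rw [← hθs, adj, s1, hr]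
    rw [hdBD, Matrix.smul_mulVec, Matrix.add_mulVec, vecMulVec_mulVec, vecMulVec_mulVec, h1, h2]
    simp only [op_smul_eq_smul, dotProduct_smul, dotProduct_add, smul_eq_mul]
    rw [dotProduct_comm pt θs, dotProduct_comm pt]
    ring
  rw [e1, e2, e3, hMu, dotProduct_comm μ1 u]
  ring

end Cancellation

/-! ### Calculus of coordinate partial derivatives. -/

section PartialDerivatives

open Filter Topology

variable {ι : Type} [Fintype ι] [DecidableEq ι]

omit [Fintype ι] in
lemma pd_congr {F G : (ι → ℝ) → ℝ} {q : ι → ℝ} (h : F =ᶠ[𝓝 q] G) (α : ι) :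
    pd α F q = pd α G q := by
  rw [pd, pd, h.fderiv_eq]

omit [Fintype ι] in
lemma pd_congr_on {U : Set (ι → ℝ)} (hU : IsOpen U) {F G : (ι → ℝ) → ℝ}
    (h : ∀ q ∈ U, F q = G q) {q : ι → ℝ} (hq : q ∈ U) (α : ι) : pd α F q = pd α G q :=
  pd_congr (eventually_of_mem (hU.mem_nhds hq) h) α

omit [Fintype ι] in
@[simp] lemma pd_const (c : ℝ) (α : ι) (q : ι → ℝ) : pd α (fun _ => c) q = 0 := by
  simp [pd]

lemma pd_add {F G : (ι → ℝ) → ℝ} {q : ι → ℝ} (hF : DifferentiableAt ℝ F q)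
    (hG : DifferentiableAt ℝ G q) (α : ι) :
    pd α (fun q => F q + G q) q = pd α F q + pd α G q := by
  simp [pd, fderiv_fun_add hF hG]

lemma pd_sub {F G : (ι → ℝ) → ℝ} {q : ι → ℝ} (hF : DifferentiableAt ℝ F q)
    (hG : DifferentiableAt ℝ G q) (α : ι) :
    pd α (fun q => F q - G q) q = pd α F q - pd α G q := by
  simp [pd, fderiv_fun_sub hF hG]

lemma pd_mul {F G : (ι → ℝ) → ℝ} {q : ι → ℝ} (hF : DifferentiableAt ℝ F q)
    (hG : DifferentiableAt ℝ G q) (α : ι) :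
    pd α (fun q => F q * G q) q = pd α F q * G q + F q * pd α G q := by
  simp [pd, fderiv_fun_mul hF hG]
  ring

lemma pd_const_mul (c : ℝ) {G : (ι → ℝ) → ℝ} {q : ι → ℝ} (hG : DifferentiableAt ℝ G q) (α : ι) :
    pd α (fun q => c * G q) q = c * pd α G q := by
  rw [pd_mul (differentiableAt_const c) hG, pd_const, zero_mul, zero_add]

lemma pd_mul_const (c : ℝ) {G : (ι → ℝ) → ℝ} {q : ι → ℝ} (hG : DifferentiableAt ℝ G q) (α : ι) :
    pd α (fun q => G q * c) q = pd α G q * c := by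
  rw [pd_mul hG (differentiableAt_const c), pd_const, mul_zero, add_zero]

lemma pd_sum {κ : Type*} {s : Finset κ} {F : κ → (ι → ℝ) → ℝ} {q : ι → ℝ}
    (hF : ∀ k ∈ s, DifferentiableAt ℝ (F k) q) (α : ι) :
    pd α (fun q => ∑ k ∈ s, F k q) q = ∑ k ∈ s, pd α (F k) q := by
  simp [pd, fderiv_fun_sum hF]

lemma fderiv_apply_eq_sum_pd (F : (ι → ℝ) → ℝ) (q w : ι → ℝ) :
    fderiv ℝ F q w = ∑ α, w α * pd α F q := by
  conv_lhs => rw [pi_eq_sum_univ' w]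
  simp only [map_sum, map_smul, smul_eq_mul, pd]

lemma contDiffOn_pd {U : Set (ι → ℝ)} (hU : IsOpen U) {F : (ι → ℝ) → ℝ}
    (hF : ContDiffOn ℝ ∞ F U) (α : ι) : ContDiffOn ℝ ∞ (pd α F) U :=
  (hF.fderiv_of_isOpen hU (by simp)).clm_apply contDiffOn_const

lemma pd_comm {U : Set (ι → ℝ)} (hU : IsOpen U) {F : (ι → ℝ) → ℝ}
    (hF : ContDiffOn ℝ ∞ F U) {q : ι → ℝ} (hq : q ∈ U) (α β : ι) :
    pd α (pd β F) q = pd β (pd α F) q := by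
  have hd : DifferentiableAt ℝ (fderiv ℝ F) q :=
    ((hF.fderiv_of_isOpen (m := ∞) hU (by simp)).differentiableOn (by simp)).differentiableAt
      (hU.mem_nhds hq)
  have h : ∀ γ δ : ι, pd γ (pd δ F) q =
      fderiv ℝ (fderiv ℝ F) q (Pi.single γ 1) (Pi.single δ 1) := by
    intro γ δ
    change fderiv ℝ (fun q' => fderiv ℝ F q' (Pi.single δ 1)) q (Pi.single γ 1) = _
    rw [fderiv_clm_apply hd (differentiableAt_const _)]
    simp
  rw [h, h]
  exact ((hF.contDiffAt (hU.mem_nhds hq)).isSymmSndFDerivAt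
    (by simpa using WithTop.coe_le_coe.mpr (le_top (a := (2 : ℕ∞))))).eq _ _

omit [DecidableEq ι] in
lemma differentiableAt_of_contDiffOn {U : Set (ι → ℝ)} (hU : IsOpen U) {F : (ι → ℝ) → ℝ}
    (hF : ContDiffOn ℝ ∞ F U) {q : ι → ℝ} (hq : q ∈ U) : DifferentiableAt ℝ F q :=
  (hF.differentiableOn (by simp)).differentiableAt (hU.mem_nhds hq)

end PartialDerivatives

/-! ### Differentiability of determinants and inverse matrices. -/

section MatrixDifferentiability

variable {ι : Type*} [Fintype ι] [DecidableEq ι] {E : Type*} [NormedAddCommGroup E]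
  [NormedSpace ℝ E]

lemma differentiableAt_det {M : E → Matrix ι ι ℝ} {z : E}
    (hM : ∀ i j, DifferentiableAt ℝ (fun z => M z i j) z) :
    DifferentiableAt ℝ (fun z => (M z).det) z := by
  simp only [Matrix.det_apply]
  refine DifferentiableAt.fun_sum fun σ _ => DifferentiableAt.const_smul ?_ _
  exact (HasFDerivAt.finsetProd fun i _ => (hM (σ i) i).hasFDerivAt).differentiableAt

/-- By Cramer's rule the entries of the inverse are quotients of determinants. -/
lemma differentiableAt_inv {M : E → Matrix ι ι ℝ} {z : E}
    (hM : ∀ i j, DifferentiableAt ℝ (fun z => M z i j) z) (hz : (M z).det ≠ 0) (i j : ι) :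
    DifferentiableAt ℝ (fun z => (M z)⁻¹ i j) z := by
  simp only [Matrix.inv_def, Ring.inverse_eq_inv', Matrix.smul_apply, smul_eq_mul,
    Matrix.adjugate_apply]
  refine ((differentiableAt_det hM).inv hz).mul (differentiableAt_det fun k l => ?_)
  simp only [Matrix.updateRow_apply]
  split_ifs
  · exact differentiableAt_const _
  · exact hM _ _

end MatrixDifferentiability

/-! ### Levi-Civita connection and special conformal Killing tensors in matrix form. -/

section Geometry

open Filter Topology Matrix

variable {ι : Type} [Fintype ι] [DecidableEq ι] {U : Set (ι → ℝ)}
  {g J : (ι → ℝ) → Matrix ι ι ℝ}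

/-- `(Γ^σ_{βγ})` as a matrix in `σ` and `β`. -/
noncomputable def gammaMat (g : (ι → ℝ) → Matrix ι ι ℝ) (q : ι → ℝ) (γ : ι) : Matrix ι ι ℝ :=
  Matrix.of fun σ β => christoffel g q σ β γ

/-- The matrix of the partial derivatives of the entries. -/
noncomputable def pdMat (γ : ι) (M : (ι → ℝ) → Matrix ι ι ℝ) (q : ι → ℝ) : Matrix ι ι ℝ :=
  Matrix.of fun α β => pd γ (fun q' => M q' α β) q

omit [DecidableEq ι] in
lemma IsRiemannianMetric.apply_symm (hg : IsRiemannianMetric U g) {q : ι → ℝ} (hq : q ∈ U)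
    (α β : ι) : g q α β = g q β α := by
  simpa using (hg.posDef q hq).1.apply β α

omit [DecidableEq ι] in
lemma IsRiemannianMetric.transpose_eq (hg : IsRiemannianMetric U g) {q : ι → ℝ} (hq : q ∈ U) :
    (g q)ᵀ = g q := by
  ext α β
  exact hg.apply_symm hq β α

lemma IsRiemannianMetric.isUnit_det (hg : IsRiemannianMetric U g) {q : ι → ℝ} (hq : q ∈ U) :
    IsUnit (g q).det :=
  isUnit_iff_ne_zero.mpr (hg.posDef q hq).det_pos.ne'

lemma IsRiemannianMetric.pd_symm (hg : IsRiemannianMetric U g) (hU : IsOpen U) {q : ι → ℝ}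
    (hq : q ∈ U) (γ α β : ι) : pd γ (fun q' => g q' α β) q = pd γ (fun q' => g q' β α) q :=
  pd_congr_on hU (fun _ h => hg.apply_symm h α β) hq γ

lemma IsRiemannianMetric.christoffel_symm (hg : IsRiemannianMetric U g) (hU : IsOpen U)
    {q : ι → ℝ} (hq : q ∈ U) (α β γ : ι) : christoffel g q α β γ = christoffel g q α γ β := by
  rw [christoffel, christoffel]
  congr 1
  refine Finset.sum_congr rfl fun σ _ => ?_
  rw [hg.pd_symm hU hq σ β γ]
  ring

lemma IsRiemannianMetric.sum_mul_christoffel (hg : IsRiemannianMetric U g) {q : ι → ℝ}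
    (hq : q ∈ U) (α β γ : ι) : ∑ σ, g q α σ * christoffel g q σ β γ =
      (1 / 2) * (pd β (fun q' => g q' α γ) q + pd γ (fun q' => g q' α β) q
        - pd α (fun q' => g q' β γ) q) := by
  set w : ι → ℝ := fun σ => pd β (fun q' => g q' σ γ) q + pd γ (fun q' => g q' σ β) q
        - pd σ (fun q' => g q' β γ) q with hw
  have h : (fun σ => christoffel g q σ β γ) = (1 / 2 : ℝ) • ((g q)⁻¹ *ᵥ w) := by
    ext σ
    simp [christoffel, hw, Matrix.mulVec, dotProduct]
  have h2 : g q *ᵥ (fun σ => christoffel g q σ β γ) = (1 / 2 : ℝ) • w := by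
    rw [h, Matrix.mulVec_smul, Matrix.mulVec_mulVec,
      Matrix.mul_nonsing_inv _ (hg.isUnit_det hq), Matrix.one_mulVec]
  exact congrFun h2 α

lemma IsRiemannianMetric.pdMat_metric (hg : IsRiemannianMetric U g) (hU : IsOpen U) {q : ι → ℝ}
    (hq : q ∈ U) (γ : ι) :
    pdMat γ g q = g q * gammaMat g q γ + (gammaMat g q γ)ᵀ * g q := by
  ext α β
  have h1 := hg.sum_mul_christoffel hq α β γ
  have h2 := hg.sum_mul_christoffel hq β α γ
  have h3 : ∑ σ, christoffel g q σ α γ * g q σ β = ∑ σ, g q β σ * christoffel g q σ α γ :=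
    Finset.sum_congr rfl fun σ _ => by rw [hg.apply_symm hq σ β, mul_comm]
  simp only [pdMat, gammaMat, Matrix.of_apply, Matrix.add_apply, Matrix.mul_apply,
    Matrix.transpose_apply]
  rw [h3, h1, h2, hg.pd_symm hU hq γ β α]
  ring

/-- The partial derivatives of a special conformal Killing tensor of type `(1,1)`. -/
lemma pdMat_of_killing (hg : IsRiemannianMetric U g) (hU : IsOpen U)
    (hJ : ∀ α β, ContDiffOn ℝ ∞ (fun q => J q α β) U) {q θ : ι → ℝ} (hq : q ∈ U)
    (hθ : ∀ α β γ, covDerivLower g J q α β γ = (1 / 2) * (θ α * g q β γ + θ β * g q α γ))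
    (γ : ι) :
    pdMat γ J q = J q * gammaMat g q γ - gammaMat g q γ * J q +
      (1 / 2 : ℝ) • (vecMulVec ((g q)⁻¹ *ᵥ θ) (fun β => g q β γ) + vecMulVec (Pi.single γ 1) θ) := by
  have hu := hg.isUnit_det hq
  have h1 : pdMat γ (fun q => g q * J q) q = pdMat γ g q * J q + g q * pdMat γ J q := by
    ext α β
    simp only [pdMat, Matrix.of_apply, Matrix.add_apply, Matrix.mul_apply]
    rw [← Finset.sum_add_distrib, pd_sum fun σ _ =>
      (differentiableAt_of_contDiffOn hU (hg.smooth α σ) hq).fun_mul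
        (differentiableAt_of_contDiffOn hU (hJ σ β) hq)]
    exact Finset.sum_congr rfl fun σ _ => pd_mul
      (differentiableAt_of_contDiffOn hU (hg.smooth α σ) hq)
      (differentiableAt_of_contDiffOn hU (hJ σ β) hq) γ
  -- The Killing equation solved for `∂_γ (gJ)`, to be compared with the product rule `h1`. The term
  -- `Γᵀ g J` occurs in both, and `g` is then cancelled on the left.
  have h2 : pdMat γ (fun q => g q * J q) q = g q * J q * gammaMat g q γ +
      (gammaMat g q γ)ᵀ * (g q * J q) + (1 / 2 : ℝ) •
        (vecMulVec θ (fun β => g q β γ) + vecMulVec (fun α => g q α γ) θ) := by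
    ext α β
    have h := hθ α β γ
    rw [covDerivLower] at h
    have e1 : (g q * J q * gammaMat g q γ) α β =
        ∑ σ, christoffel g q σ β γ * (g q * J q) α σ := by
      rw [Matrix.mul_apply]
      exact Finset.sum_congr rfl fun σ _ => mul_comm _ _
    have e2 : ((gammaMat g q γ)ᵀ * (g q * J q)) α β =
        ∑ σ, christoffel g q σ α γ * (g q * J q) σ β := by
      rw [Matrix.mul_apply]
      rfl
    simp only [pdMat, Matrix.of_apply, Matrix.add_apply, e1, e2, Matrix.smul_apply, smul_eq_mul,
      vecMulVec_apply]
    linarith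
  rw [h1, hg.pdMat_metric hU hq] at h2
  have h3 : g q * pdMat γ J q = g q * (J q * gammaMat g q γ - gammaMat g q γ * J q +
      (1 / 2 : ℝ) • (vecMulVec ((g q)⁻¹ *ᵥ θ) (fun β => g q β γ) +
        vecMulVec (Pi.single γ 1) θ)) := by
    have e1 : g q *ᵥ Pi.single γ 1 = fun α => g q α γ := by
      ext α
      simp
    rw [Matrix.mul_add, Matrix.mul_sub, Matrix.mul_smul, Matrix.mul_add, Matrix.mul_vecMulVec,
      Matrix.mul_vecMulVec, Matrix.mulVec_mulVec, Matrix.mul_nonsing_inv _ hu, Matrix.one_mulVec,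
      e1, ← Matrix.mul_assoc, ← Matrix.mul_assoc]
    rw [Matrix.add_mul, Matrix.mul_assoc (gammaMat g q γ)ᵀ] at h2
    rw [← sub_eq_zero] at h2 ⊢
    rw [← h2]
    abel
  have h4 := congrArg (fun Z => (g q)⁻¹ * Z) h3
  simpa only [← Matrix.mul_assoc, Matrix.nonsing_inv_mul _ hu, Matrix.one_mul] using h4

/-- In `pdMat_of_killing` the commutator with the connection is traceless, and each rank-one term
has trace `θ_γ`. This identifies the 1-form as `d(tr J)`. -/
lemma pd_trace_of_killing (hg : IsRiemannianMetric U g) (hU : IsOpen U)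
    (hJ : ∀ α β, ContDiffOn ℝ ∞ (fun q => J q α β) U) {q θ : ι → ℝ} (hq : q ∈ U)
    (hθ : ∀ α β γ, covDerivLower g J q α β γ = (1 / 2) * (θ α * g q β γ + θ β * g q α γ))
    (γ : ι) : pd γ (fun q => (J q).trace) q = θ γ := by
  have h1 : pd γ (fun q => (J q).trace) q = (pdMat γ J q).trace := by
    simp only [Matrix.trace, Matrix.diag_apply]
    exact pd_sum (fun α _ => differentiableAt_of_contDiffOn hU (hJ α α) hq) γ
  have h2 : (fun β => g q β γ) = g q *ᵥ Pi.single γ 1 := by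
    ext α
    simp
  have h3 : ((g q)⁻¹ *ᵥ θ) ⬝ᵥ (fun β => g q β γ) = θ γ := by
    rw [h2, Matrix.dotProduct_mulVec, ← Matrix.mulVec_transpose, hg.transpose_eq hq,
      Matrix.mulVec_mulVec, Matrix.mul_nonsing_inv _ (hg.isUnit_det hq), Matrix.one_mulVec]
    simp
  rw [h1, pdMat_of_killing hg hU hJ hq hθ, Matrix.trace_add, Matrix.trace_sub,
    Matrix.trace_mul_comm (J q), sub_self, zero_add, Matrix.trace_smul, Matrix.trace_add,
    trace_vecMulVec, trace_vecMulVec, h3, single_one_dotProduct, smul_eq_mul]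
  ring

end Geometry

/-! ### The connection of the equations of motion. -/

section Connection

variable {ι : Type} [Fintype ι] [DecidableEq ι] {U : Set (ι → ℝ)} {g : (ι → ℝ) → Matrix ι ι ℝ}

omit [Fintype ι] in
lemma pd_apply (β γ : ι) (v : ι → ℝ) : pd β (fun w => w γ) v = if γ = β then 1 else 0 := by
  have : fderiv ℝ (fun w : ι → ℝ => w γ) v = ContinuousLinearMap.proj γ :=
    (ContinuousLinearMap.proj (R := ℝ) (φ := fun _ : ι => ℝ) γ).fderiv
  rw [pd, this]
  simp [Pi.single_apply]

/-- The connection coefficients of the equations of motion are `Γ^α_{βγ} v^γ`. -/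
lemma conn_sode (hg : IsRiemannianMetric U g) (hU : IsOpen U) (μ : (ι → ℝ) → ι → ℝ)
    {q : ι → ℝ} (hq : q ∈ U) (α β : ι) (v : ι → ℝ) :
    conn (sode g μ) α β q v = ∑ γ, christoffel g q α β γ * v γ := by
  have hd : ∀ γ, DifferentiableAt ℝ (fun w : ι → ℝ => w γ) v := fun γ => by fun_prop
  have h1 : ∀ δ γ, pd β (fun w : ι → ℝ => christoffel g q α δ γ * w δ * w γ) v =
      christoffel g q α δ γ * ((if δ = β then 1 else 0) * v γ + v δ * if γ = β then 1 else 0) := by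
    intro δ γ
    rw [pd_mul ((hd δ).const_mul _) (hd γ), pd_const_mul _ (hd δ), pd_apply, pd_apply]
    ring
  have hds : ∀ δ γ, DifferentiableAt ℝ
      (fun w : ι → ℝ => christoffel g q α δ γ * w δ * w γ) v := fun δ γ => by fun_prop
  have h2 : pdv β (sode g μ α) q v =
      -∑ δ, ∑ γ, christoffel g q α δ γ *
        ((if δ = β then 1 else 0) * v γ + v δ * if γ = β then 1 else 0) := by
    have e : sode g μ α q = fun w => (∑ σ, (g q)⁻¹ α σ * μ q σ) -
        ∑ δ, ∑ γ, christoffel g q α δ γ * w δ * w γ := by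
      ext w
      rw [sode]
      ring
    rw [pdv, e, pd_sub (differentiableAt_const _)
      (DifferentiableAt.fun_sum fun δ _ => DifferentiableAt.fun_sum fun γ _ => hds δ γ),
      pd_const, zero_sub, pd_sum fun δ _ => DifferentiableAt.fun_sum fun γ _ => hds δ γ]
    congr 1
    refine Finset.sum_congr rfl fun δ _ => ?_
    rw [pd_sum fun γ _ => hds δ γ]
    exact Finset.sum_congr rfl fun γ _ => h1 δ γ
  rw [conn, h2]
  simp only [mul_add, Finset.sum_add_distrib, ite_mul, one_mul, zero_mul, mul_ite, mul_zero,
    mul_one, Finset.sum_ite_eq', Finset.mem_univ, if_true]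
  rw [Finset.sum_comm]
  simp only [Finset.sum_ite_eq', Finset.mem_univ, if_true]
  -- The two sums from differentiating a quadratic form coincide, which absorbs the factor `1/2` in
  -- `conn`.
  have : ∑ x, christoffel g q α x β * v x = ∑ γ, christoffel g q α β γ * v γ :=
    Finset.sum_congr rfl fun γ _ => by rw [hg.christoffel_symm hU hq]
  rw [this]
  ring

omit [DecidableEq ι] in
lemma isSection_const {K : (ι → ℝ) → (ι → ℝ) → Submodule ℝ (ι → ℝ)} (X : ι → ℝ)
    (hX : ∀ q ∈ U, ∀ v, X ∈ K q v) : IsSection U K fun _ _ => X :=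
  ⟨contDiffOn_const, hX⟩

lemma differentiableAt_christoffel (hg : IsRiemannianMetric U g) (hU : IsOpen U) {q : ι → ℝ}
    (hq : q ∈ U) (α β γ : ι) : DifferentiableAt ℝ (fun q => christoffel g q α β γ) q := by
  have hp : ∀ σ κ l, DifferentiableAt ℝ (fun q => pd σ (fun q' => g q' κ l) q) q :=
    fun σ κ l => differentiableAt_of_contDiffOn hU (contDiffOn_pd hU (hg.smooth κ l) σ) hq
  unfold christoffel
  refine (DifferentiableAt.fun_sum fun σ _ => ?_).const_mul _
  exact (differentiableAt_inv (fun i j => differentiableAt_of_contDiffOn hU (hg.smooth i j) hq)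
    (hg.isUnit_det hq).ne_zero α σ).mul (((hp _ _ _).add (hp _ _ _)).sub (hp _ _ _))

lemma differentiableAt_sode (hg : IsRiemannianMetric U g) (hU : IsOpen U)
    {μ : (ι → ℝ) → ι → ℝ} (hμ : ∀ α, ContDiffOn ℝ ∞ (fun q => μ q α) U) {q : ι → ℝ}
    (hq : q ∈ U) (α : ι) (v : ι → ℝ) : DifferentiableAt ℝ (fun q => sode g μ α q v) q := by
  unfold sode
  refine ((DifferentiableAt.fun_sum fun β _ => DifferentiableAt.fun_sum fun γ _ =>
    ((differentiableAt_christoffel hg hU hq α β γ).mul_const _).mul_const _).neg).add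
    (DifferentiableAt.fun_sum fun β _ => ?_)
  exact (differentiableAt_inv (fun i j => differentiableAt_of_contDiffOn hU (hg.smooth i j) hq)
    (hg.isUnit_det hq).ne_zero α β).mul (differentiableAt_of_contDiffOn hU (hμ β) hq)

end Connection

/-! ### Functions on the slices over a point or a curve of the driving coordinates. -/

section Slices

variable {m n : ℕ} {U : Set (Fin m ⊕ Fin n → ℝ)}

lemma hasFDerivAt_sumElim_right (y : Fin m → ℝ) (x : Fin n → ℝ) :
    HasFDerivAt (fun x => (Sum.elim y x : Fin m ⊕ Fin n → ℝ))
      (ContinuousLinearMap.pi (Sum.rec (fun _ => 0) fun a => ContinuousLinearMap.proj a) :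
        (Fin n → ℝ) →L[ℝ] Fin m ⊕ Fin n → ℝ) x := by
  rw [hasFDerivAt_pi]
  rintro (i | a)
  · exact hasFDerivAt_const _ _
  · exact (ContinuousLinearMap.proj (R := ℝ) (φ := fun _ : Fin n => ℝ) a).hasFDerivAt

/-- A function whose derivatives along the driven coordinates vanish is constant on the slices. -/
lemma eq_of_pd_inr_eq_zero (hU : IsOpen U) {y : Fin m → ℝ}
    (hslice : IsPreconnected {x : Fin n → ℝ | Sum.elim y x ∈ U}) {φ : (Fin m ⊕ Fin n → ℝ) → ℝ}
    (hφ : ∀ x, Sum.elim y x ∈ U → DifferentiableAt ℝ φ (Sum.elim y x))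
    (h0 : ∀ x, Sum.elim y x ∈ U → ∀ a, pd (Sum.inr a) φ (Sum.elim y x) = 0)
    {x x' : Fin n → ℝ} (hx : Sum.elim y x ∈ U) (hx' : Sum.elim y x' ∈ U) :
    φ (Sum.elim y x) = φ (Sum.elim y x') := by
  have hc : Continuous fun x => (Sum.elim y x : Fin m ⊕ Fin n → ℝ) :=
    continuous_iff_continuousAt.mpr fun x => (hasFDerivAt_sumElim_right y x).continuousAt
  have hder := fun x hx => (hφ x hx).hasFDerivAt.comp x (hasFDerivAt_sumElim_right y x)
  refine (hU.preimage hc).is_const_of_fderiv_eq_zero (𝕜 := ℝ) (f := fun x => φ (Sum.elim y x))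
    hslice (fun x hx => (hder x hx).differentiableAt.differentiableWithinAt) (fun x hx => ?_) hx hx'
  rw [Pi.zero_apply]
  refine ((hder x hx).fderiv).trans ?_
  ext w
  rw [ContinuousLinearMap.comp_apply, fderiv_apply_eq_sum_pd, Fintype.sum_sum_type]
  simp [h0 x hx]

/-- The chain rule along a curve in the driving coordinates. -/
lemma hasDerivAt_comp_sumElim_left {φ : (Fin m ⊕ Fin n → ℝ) → ℝ} {y : ℝ → Fin m → ℝ}
    {w : Fin m → ℝ} {t : ℝ} {x : Fin n → ℝ} (hφ : DifferentiableAt ℝ φ (Sum.elim (y t) x))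
    (hy : ∀ i, HasDerivAt (fun s => y s i) (w i) t) :
    HasDerivAt (fun s => φ (Sum.elim (y s) x))
      (∑ j, pd (Sum.inl j) φ (Sum.elim (y t) x) * w j) t := by
  have h1 : HasDerivAt (fun s => (Sum.elim (y s) x : Fin m ⊕ Fin n → ℝ)) (Sum.elim w 0) t := by
    rw [hasDerivAt_pi]
    rintro (i | a)
    · exact hy i
    · exact hasDerivAt_const _ _
  have h2 := hφ.hasFDerivAt.comp_hasDerivAt t h1
  rw [fderiv_apply_eq_sum_pd, Fintype.sum_sum_type] at h2
  simp only [Sum.elim_inl, Sum.elim_inr, Pi.zero_apply, zero_mul, Finset.sum_const_zero,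
    add_zero] at h2
  simp only [mul_comm] at h2 ⊢
  exact h2

/-- The chain rule along a coordinate line in the driven coordinates. -/
lemma hasDerivAt_comp_sumElim_update {φ : (Fin m ⊕ Fin n → ℝ) → ℝ} {y : Fin m → ℝ}
    {x : Fin n → ℝ} (hφ : DifferentiableAt ℝ φ (Sum.elim y x)) (a : Fin n) :
    HasDerivAt (fun s => φ (Sum.elim y (Function.update x a s)))
      (pd (Sum.inr a) φ (Sum.elim y x)) (x a) := by
  have h1 : HasDerivAt (fun s => (Sum.elim y (Function.update x a s) : Fin m ⊕ Fin n → ℝ))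
      (Pi.single (Sum.inr a) 1) (x a) := by
    rw [hasDerivAt_pi]
    rintro (i | b)
    · simpa using hasDerivAt_const (x a) (y i)
    · simp only [Sum.elim_inr, Function.update_apply]
      split_ifs with h
      · subst h
        simpa using hasDerivAt_id' (x b)
      · simpa [h] using hasDerivAt_const (x a) (x b)
  have h2 : DifferentiableAt ℝ φ (Sum.elim y (Function.update x a (x a))) := by
    rwa [Function.update_eq_self]
  have h3 := h2.hasFDerivAt.comp_hasDerivAt (x a) h1
  rwa [Function.update_eq_self] at h3

end Slices

/-! ### Splitting of the metric and of the driving equations in adapted coordinates. -/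

section AdaptedGeometry

open Matrix

variable {m n : ℕ} {U : Set (Fin m ⊕ Fin n → ℝ)}
  {g : (Fin m ⊕ Fin n → ℝ) → Matrix (Fin m ⊕ Fin n) (Fin m ⊕ Fin n) ℝ}
  {μ : (Fin m ⊕ Fin n → ℝ) → Fin m ⊕ Fin n → ℝ}
  {J : (Fin m ⊕ Fin n → ℝ) → Matrix (Fin m ⊕ Fin n) (Fin m ⊕ Fin n) ℝ}
  {K : (Fin m ⊕ Fin n → ℝ) → (Fin m ⊕ Fin n → ℝ) → Submodule ℝ (Fin m ⊕ Fin n → ℝ)}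

lemma IsAdapted.single_mem (hA : IsAdapted U g K) {q : Fin m ⊕ Fin n → ℝ} (hq : q ∈ U)
    (v : Fin m ⊕ Fin n → ℝ) (a : Fin n) : Pi.single (Sum.inr a) 1 ∈ K q v :=
  (hA q hq v _).1.mpr fun i => by simp

lemma IsAdapted.metric_inl_inr (hA : IsAdapted U g K) {q : Fin m ⊕ Fin n → ℝ} (hq : q ∈ U)
    (i : Fin m) (a : Fin n) : g q (Sum.inl i) (Sum.inr a) = 0 := by
  have h := (hA q hq 0 (Pi.single (Sum.inl i) 1)).2.mpr (fun b => by simp) _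
    (hA.single_mem hq 0 a)
  simpa [Pi.single_apply] using h

/-- The driven block is not void. -/
lemma IsDrivenCofactorSystem.pos_of_isAdapted (hsys : IsDrivenCofactorSystem U g μ J K)
    (hA : IsAdapted U g K) : 0 < n := by
  obtain ⟨q, hq, v, X, Y, -, hY, hne⟩ := hsys.coupling
  by_contra hn
  obtain rfl : n = 0 := by omega
  refine hne ?_
  have : Y = 0 := by
    ext (i | a)
    · exact (hA q hq v Y).1.mp hY i
    · exact a.elim0
  simp [horCovForm, this]

/-- For the constant section `∂/∂x^a` the derivative along the second-order field is zero, so `∇` of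
it has the components `Γ^α_a`; lying in `K` means that those with `α = i` vanish. -/
lemma IsDrivenCofactorSystem.conn_inl_inr (hsys : IsDrivenCofactorSystem U g μ J K)
    (hA : IsAdapted U g K) {q : Fin m ⊕ Fin n → ℝ} (hq : q ∈ U) (i : Fin m) (a : Fin n)
    (v : Fin m ⊕ Fin n → ℝ) : conn (sode g μ) (Sum.inl i) (Sum.inr a) q v = 0 := by
  have h := (hA q hq v _).1.mp (hsys.nabla _
    (isSection_const (Pi.single (Sum.inr a) 1) fun q hq v => hA.single_mem hq v a) q hq v) i
  simpa [dynCov, sodeField, pdq, pdv, Pi.single_apply] using h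

/-- `Γ^i_a` is linear in the velocity and vanishes for every velocity; the basis vectors give the
individual symbols. -/
lemma IsDrivenCofactorSystem.christoffel_inl_inr (hsys : IsDrivenCofactorSystem U g μ J K)
    (hA : IsAdapted U g K) (hU : IsOpen U) {q : Fin m ⊕ Fin n → ℝ} (hq : q ∈ U)
    (i : Fin m) (a : Fin n) (γ : Fin m ⊕ Fin n) :
    christoffel g q (Sum.inl i) (Sum.inr a) γ = 0 := by
  have h := hsys.conn_inl_inr hA hq i a (Pi.single γ 1)
  rw [conn_sode hsys.cofactor.metric hU μ hq] at h
  simpa [Pi.single_apply] using h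

/-- As `g` is block diagonal, lowering the index of `Γ^i_{aj} = 0` leaves only `∂g_kj/∂x^a`. In the
same way `Γ^i_{ab} = 0` gives `pd_inl_metric`, so that `g` is locally a product metric. -/
lemma IsDrivenCofactorSystem.pd_inr_metric (hsys : IsDrivenCofactorSystem U g μ J K)
    (hA : IsAdapted U g K) (hU : IsOpen U) {q : Fin m ⊕ Fin n → ℝ} (hq : q ∈ U)
    (a : Fin n) (k j : Fin m) : pd (Sum.inr a) (fun q => g q (Sum.inl k) (Sum.inl j)) q = 0 := by
  have hz : ∀ γ (i : Fin m) (b : Fin n), pd γ (fun q => g q (Sum.inl i) (Sum.inr b)) q = 0 :=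
    fun γ i b => (pd_congr_on hU (fun _ h => hA.metric_inl_inr h i b) hq γ).trans (pd_const 0 γ q)
  have h := hsys.cofactor.metric.sum_mul_christoffel hq (Sum.inl k) (Sum.inr a) (Sum.inl j)
  rw [Fintype.sum_sum_type] at h
  simp only [hsys.christoffel_inl_inr hA hU hq, hA.metric_inl_inr hq, mul_zero, zero_mul,
    Finset.sum_const_zero, add_zero, hz,
    hsys.cofactor.metric.pd_symm hU hq _ (Sum.inr a) (Sum.inl j), sub_zero] at h
  linarith

lemma IsDrivenCofactorSystem.pd_inl_metric (hsys : IsDrivenCofactorSystem U g μ J K)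
    (hA : IsAdapted U g K) (hU : IsOpen U) {q : Fin m ⊕ Fin n → ℝ} (hq : q ∈ U)
    (k : Fin m) (a b : Fin n) : pd (Sum.inl k) (fun q => g q (Sum.inr a) (Sum.inr b)) q = 0 := by
  have hz : ∀ γ (i : Fin m) (b : Fin n), pd γ (fun q => g q (Sum.inl i) (Sum.inr b)) q = 0 :=
    fun γ i b => (pd_congr_on hU (fun _ h => hA.metric_inl_inr h i b) hq γ).trans (pd_const 0 γ q)
  have h := hsys.cofactor.metric.sum_mul_christoffel hq (Sum.inl k) (Sum.inr a) (Sum.inr b)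
  rw [Fintype.sum_sum_type] at h
  simp only [hsys.christoffel_inl_inr hA hU hq, hA.metric_inl_inr hq, mul_zero, zero_mul,
    Finset.sum_const_zero, add_zero, hz, zero_sub] at h
  linarith

lemma IsAdapted.metric_eq_fromBlocks (hA : IsAdapted U g K) (hg : IsRiemannianMetric U g)
    {q : Fin m ⊕ Fin n → ℝ} (hq : q ∈ U) :
    g q = fromBlocks (g q).toBlocks₁₁ 0 0 (g q).toBlocks₂₂ := by
  ext (i | a) (j | b)
  · rfl
  · exact hA.metric_inl_inr hq i b
  · exact (hg.apply_symm hq _ _).trans (hA.metric_inl_inr hq j a)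
  · rfl

lemma IsAdapted.det_metric_blocks (hA : IsAdapted U g K) (hg : IsRiemannianMetric U g)
    {q : Fin m ⊕ Fin n → ℝ} (hq : q ∈ U) :
    (g q).toBlocks₁₁.det ≠ 0 ∧ (g q).toBlocks₂₂.det ≠ 0 := by
  have h := (hg.isUnit_det hq).ne_zero
  rw [hA.metric_eq_fromBlocks hg hq, det_fromBlocks_zero₁₂] at h
  exact mul_ne_zero_iff.mp h

lemma IsAdapted.inv_metric_eq_fromBlocks (hA : IsAdapted U g K) (hg : IsRiemannianMetric U g)
    {q : Fin m ⊕ Fin n → ℝ} (hq : q ∈ U) :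
    (g q)⁻¹ = fromBlocks (g q).toBlocks₁₁⁻¹ 0 0 (g q).toBlocks₂₂⁻¹ := by
  obtain ⟨h1, h2⟩ := hA.det_metric_blocks hg hq
  refine Matrix.inv_eq_right_inv ?_
  conv_lhs => enter [1]; rw [hA.metric_eq_fromBlocks hg hq]
  rw [fromBlocks_multiply, Matrix.mul_nonsing_inv _ (isUnit_iff_ne_zero.mpr h1),
    Matrix.mul_nonsing_inv _ (isUnit_iff_ne_zero.mpr h2)]
  simp

lemma IsDrivenCofactorSystem.christoffel_inr_inl (hsys : IsDrivenCofactorSystem U g μ J K)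
    (hA : IsAdapted U g K) (hU : IsOpen U) {q : Fin m ⊕ Fin n → ℝ} (hq : q ∈ U)
    (a : Fin n) (i : Fin m) (γ : Fin m ⊕ Fin n) :
    christoffel g q (Sum.inr a) (Sum.inl i) γ = 0 := by
  have hg := hsys.cofactor.metric
  have hz : ∀ γ (i : Fin m) (b : Fin n), pd γ (fun q => g q (Sum.inl i) (Sum.inr b)) q = 0 :=
    fun γ i b => (pd_congr_on hU (fun _ h => hA.metric_inl_inr h i b) hq γ).trans (pd_const 0 γ q)
  have hz' : ∀ γ (i : Fin m) (b : Fin n), pd γ (fun q => g q (Sum.inr b) (Sum.inl i)) q = 0 :=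
    fun γ i b => (hg.pd_symm hU hq γ _ _).trans (hz γ i b)
  rw [christoffel, hA.inv_metric_eq_fromBlocks hg hq, Fintype.sum_sum_type]
  rcases γ with j | b
  · simp [hz', hsys.pd_inr_metric hA hU hq]
  · simp [hz, hz', hsys.pd_inl_metric hA hU hq]

lemma IsDrivenCofactorSystem.gammaMat_inr (hsys : IsDrivenCofactorSystem U g μ J K)
    (hA : IsAdapted U g K) (hU : IsOpen U) {q : Fin m ⊕ Fin n → ℝ} (hq : q ∈ U) (b : Fin n) :
    gammaMat g q (Sum.inr b) = fromBlocks 0 0 0 (gammaMat g q (Sum.inr b)).toBlocks₂₂ := by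
  have hs := hsys.cofactor.metric.christoffel_symm hU hq
  ext (i | a) (j | c)
  · exact (hs _ _ _).trans (hsys.christoffel_inl_inr hA hU hq i b _)
  · exact hsys.christoffel_inl_inr hA hU hq i c _
  · exact hsys.christoffel_inr_inl hA hU hq a j _
  · rfl

lemma IsDrivenCofactorSystem.gammaMat_inl (hsys : IsDrivenCofactorSystem U g μ J K)
    (hA : IsAdapted U g K) (hU : IsOpen U) {q : Fin m ⊕ Fin n → ℝ} (hq : q ∈ U) (k : Fin m) :
    gammaMat g q (Sum.inl k) = fromBlocks (gammaMat g q (Sum.inl k)).toBlocks₁₁ 0 0 0 := by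
  have hs := hsys.cofactor.metric.christoffel_symm hU hq
  ext (i | a) (j | c)
  · rfl
  · exact hsys.christoffel_inl_inr hA hU hq i c _
  · exact hsys.christoffel_inr_inl hA hU hq a j _
  · exact (hs _ _ _).trans (hsys.christoffel_inr_inl hA hU hq a k _)

/-- The driving equations do not depend on the driven coordinates. -/
lemma IsDrivenCofactorSystem.pd_inr_sode (hsys : IsDrivenCofactorSystem U g μ J K)
    (hA : IsAdapted U g K) (hU : IsOpen U) {q : Fin m ⊕ Fin n → ℝ} (hq : q ∈ U) (a : Fin n)
    (i : Fin m) (v : Fin m ⊕ Fin n → ℝ) :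
    pd (Sum.inr a) (fun q => sode g μ (Sum.inl i) q v) q = 0 := by
  have h := (hA q hq v _).1.mp (hsys.jacobi _
    (isSection_const (Pi.single (Sum.inr a) 1) fun q hq v => hA.single_mem hq v a) q hq v) i
  have hz : ∀ q ∈ U, ∀ b v, conn (sode g μ) (Sum.inl i) (Sum.inr b) q v = 0 :=
    fun q hq b v => hsys.conn_inl_inr hA hq i b v
  have h1 : sodeField (sode g μ) (conn (sode g μ) (Sum.inl i) (Sum.inr a)) q v = 0 := by
    refine Finset.sum_eq_zero fun α _ => ?_
    have e1 : pdq α (conn (sode g μ) (Sum.inl i) (Sum.inr a)) q v = 0 :=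
      (pd_congr_on hU (fun q hq => hz q hq a v) hq α).trans (pd_const 0 α q)
    have e2 : pdv α (conn (sode g μ) (Sum.inl i) (Sum.inr a)) q v = 0 := by
      have : conn (sode g μ) (Sum.inl i) (Sum.inr a) q = fun _ => 0 := by
        ext v
        exact hz q hq a v
      rw [pdv, this, pd_const]
    rw [e1, e2, mul_zero, mul_zero, add_zero]
  -- For either type of `γ` one of the factors is a coefficient `Γ^j_b = 0`. So `Φ^i_a` reduces to
  -- `-∂f^i/∂x^a`.
  have h2 : ∑ γ, conn (sode g μ) (Sum.inl i) γ q v * conn (sode g μ) γ (Sum.inr a) q v = 0 := by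
    rw [Fintype.sum_sum_type]
    simp [hz q hq, fun j => hsys.conn_inl_inr hA hq j a v]
  rw [Matrix.mulVec_single_one, Matrix.col_apply, jacobiEndo, h1, h2, sub_zero, sub_zero,
    neg_eq_zero] at h
  exact h

end AdaptedGeometry

/-! ### The Killing equation in blocks. -/

section AdaptedTensor

open Matrix

variable {m n : ℕ} {U : Set (Fin m ⊕ Fin n → ℝ)}
  {g : (Fin m ⊕ Fin n → ℝ) → Matrix (Fin m ⊕ Fin n) (Fin m ⊕ Fin n) ℝ}
  {μ : (Fin m ⊕ Fin n → ℝ) → Fin m ⊕ Fin n → ℝ}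
  {J : (Fin m ⊕ Fin n → ℝ) → Matrix (Fin m ⊕ Fin n) (Fin m ⊕ Fin n) ℝ}
  {K : (Fin m ⊕ Fin n → ℝ) → (Fin m ⊕ Fin n → ℝ) → Submodule ℝ (Fin m ⊕ Fin n → ℝ)}

lemma IsAdapted.inv_metric_mulVec_inl (hA : IsAdapted U g K) (hg : IsRiemannianMetric U g)
    {q : Fin m ⊕ Fin n → ℝ} (hq : q ∈ U) (θ : Fin m ⊕ Fin n → ℝ) (i : Fin m) :
    ((g q)⁻¹ *ᵥ θ) (Sum.inl i) = ((g q).toBlocks₁₁⁻¹ *ᵥ (θ ∘ Sum.inl)) i := by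
  rw [hA.inv_metric_eq_fromBlocks hg hq, fromBlocks_mulVec]
  simp

section Killing

variable (hsys : IsDrivenCofactorSystem U g μ J K) (hA : IsAdapted U g K) (hU : IsOpen U)
  {q θ : Fin m ⊕ Fin n → ℝ} (hq : q ∈ U)
  (hθ : ∀ α β γ, covDerivLower g J q α β γ = (1 / 2) * (θ α * g q β γ + θ β * g q α γ))

include hsys hA hU hq hθ

/-- The connection matrix in the direction `∂/∂x^b` has only a driven block, so the commutator has
no driving block. The rank-one terms drop out since `g_jb = 0` and `∂/∂x^b` has no `y`-component. -/
lemma pd_inr_block11 (b : Fin n) (i j : Fin m) :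
    pd (Sum.inr b) (fun q => J q (Sum.inl i) (Sum.inl j)) q = 0 := by
  have h := congrFun₂ (pdMat_of_killing hsys.cofactor.metric hU hsys.cofactor.scKt.smooth hq hθ
    (Sum.inr b)) (Sum.inl i) (Sum.inl j)
  rw [hsys.gammaMat_inr hA hU hq] at h
  simpa [pdMat, Matrix.mul_apply, Fintype.sum_sum_type, vecMulVec_apply,
    hA.metric_inl_inr hq] using h

lemma pd_inr_block12 (b : Fin n) (i : Fin m) (a : Fin n) :
    pd (Sum.inr b) (fun q => J q (Sum.inl i) (Sum.inr a)) q =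
      (∑ c, J q (Sum.inl i) (Sum.inr c) * christoffel g q (Sum.inr c) (Sum.inr a) (Sum.inr b)) +
      (1 / 2) * (((g q).toBlocks₁₁⁻¹ *ᵥ (θ ∘ Sum.inl)) i * g q (Sum.inr a) (Sum.inr b)) := by
  have h := congrFun₂ (pdMat_of_killing hsys.cofactor.metric hU hsys.cofactor.scKt.smooth hq hθ
    (Sum.inr b)) (Sum.inl i) (Sum.inr a)
  rw [hsys.gammaMat_inr hA hU hq] at h
  simpa [pdMat, Matrix.mul_apply, Fintype.sum_sum_type, vecMulVec_apply, toBlocks₂₂, gammaMat,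
    hA.inv_metric_mulVec_inl hsys.cofactor.metric hq] using h

lemma pd_inr_block21 (b a : Fin n) (j : Fin m) :
    pd (Sum.inr b) (fun q => J q (Sum.inr a) (Sum.inl j)) q =
      -(∑ c, christoffel g q (Sum.inr a) (Sum.inr c) (Sum.inr b) * J q (Sum.inr c) (Sum.inl j)) +
      (1 / 2) * if a = b then θ (Sum.inl j) else 0 := by
  have h := congrFun₂ (pdMat_of_killing hsys.cofactor.metric hU hsys.cofactor.scKt.smooth hq hθ
    (Sum.inr b)) (Sum.inr a) (Sum.inl j)
  rw [hsys.gammaMat_inr hA hU hq] at h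
  simpa [pdMat, Matrix.mul_apply, Fintype.sum_sum_type, vecMulVec_apply, toBlocks₂₂, gammaMat,
    hA.metric_inl_inr hq, Pi.single_apply] using h

/-- Needed for `∂ψ^i/∂y^k`, whose derivative along `x^a` is this one by equality of mixed partial
derivatives. -/
lemma pd_inl_block12 (k i : Fin m) (a : Fin n) :
    pd (Sum.inl k) (fun q => J q (Sum.inl i) (Sum.inr a)) q =
      -(∑ l, christoffel g q (Sum.inl i) (Sum.inl l) (Sum.inl k) * J q (Sum.inl l) (Sum.inr a)) +
      (1 / 2) * if i = k then θ (Sum.inr a) else 0 := by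
  have h := congrFun₂ (pdMat_of_killing hsys.cofactor.metric hU hsys.cofactor.scKt.smooth hq hθ
    (Sum.inl k)) (Sum.inl i) (Sum.inr a)
  rw [hsys.gammaMat_inl hA hU hq] at h
  have hz : g q (Sum.inr a) (Sum.inl k) = 0 :=
    (hsys.cofactor.metric.apply_symm hq _ _).trans (hA.metric_inl_inr hq k a)
  simpa [pdMat, Matrix.mul_apply, Fintype.sum_sum_type, vecMulVec_apply, toBlocks₁₁, gammaMat,
    hz, Pi.single_apply] using h

lemma pd_inl_block11 (k i j : Fin m) :
    pd (Sum.inl k) (fun q => J q (Sum.inl i) (Sum.inl j)) q =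
      (∑ l, J q (Sum.inl i) (Sum.inl l) * christoffel g q (Sum.inl l) (Sum.inl j) (Sum.inl k)) -
      (∑ l, christoffel g q (Sum.inl i) (Sum.inl l) (Sum.inl k) * J q (Sum.inl l) (Sum.inl j)) +
      (1 / 2) * (((g q).toBlocks₁₁⁻¹ *ᵥ (θ ∘ Sum.inl)) i * g q (Sum.inl j) (Sum.inl k) +
        if i = k then θ (Sum.inl j) else 0) := by
  have h := congrFun₂ (pdMat_of_killing hsys.cofactor.metric hU hsys.cofactor.scKt.smooth hq hθ
    (Sum.inl k)) (Sum.inl i) (Sum.inl j)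
  rw [hsys.gammaMat_inl hA hU hq] at h
  simpa [pdMat, Matrix.mul_apply, Fintype.sum_sum_type, vecMulVec_apply, toBlocks₁₁, gammaMat,
    hA.inv_metric_mulVec_inl hsys.cofactor.metric hq, Pi.single_apply, mul_add] using h

omit hU hθ in
lemma transpose_metric_mul_block12 :
    ((g q).toBlocks₁₁ * (J q).toBlocks₁₂)ᵀ = (g q).toBlocks₂₂ * (J q).toBlocks₂₁ := by
  ext b j
  have h := (hsys.cofactor.scKt.symm q hq).apply (Sum.inr b) (Sum.inl j)
  have hz : ∀ k, g q (Sum.inr b) (Sum.inl k) = 0 := fun k =>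
    (hsys.cofactor.metric.apply_symm hq _ _).trans (hA.metric_inl_inr hq k b)
  simpa [Matrix.mul_apply, Fintype.sum_sum_type, hA.metric_inl_inr hq, hz, toBlocks₁₁, toBlocks₁₂,
    toBlocks₂₂, toBlocks₂₁] using h

omit hU hθ in
lemma transpose_metric_mul_block11 :
    ((g q).toBlocks₁₁ * (J q).toBlocks₁₁)ᵀ = (g q).toBlocks₁₁ * (J q).toBlocks₁₁ := by
  ext i j
  have h := (hsys.cofactor.scKt.symm q hq).apply (Sum.inl i) (Sum.inl j)
  simpa [Matrix.mul_apply, Fintype.sum_sum_type, hA.metric_inl_inr hq, toBlocks₁₁] using h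

/-- The derivatives of `J^i_a J^a_j` along the driven coordinates. -/
lemma pd_inr_block12_mul_block21 (b : Fin n) (i j : Fin m) :
    pd (Sum.inr b) (fun q => ∑ a, J q (Sum.inl i) (Sum.inr a) * J q (Sum.inr a) (Sum.inl j)) q =
      (1 / 2) * (((g q).toBlocks₁₁⁻¹ *ᵥ (θ ∘ Sum.inl)) i *
          ((g q).toBlocks₁₁ *ᵥ fun k => J q (Sum.inl k) (Sum.inr b)) j +
        J q (Sum.inl i) (Sum.inr b) * θ (Sum.inl j)) := by
  have hd : ∀ α β, DifferentiableAt ℝ (fun q => J q α β) q := fun α β =>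
    differentiableAt_of_contDiffOn hU (hsys.cofactor.scKt.smooth α β) hq
  rw [pd_sum fun a _ => (hd _ _).fun_mul (hd _ _)]
  simp only [pd_mul (hd _ _) (hd _ _), pd_inr_block12 hsys hA hU hq hθ,
    pd_inr_block21 hsys hA hU hq hθ]
  -- Symmetry of `gJ` trades the driven metric block for the driving one, which is constant on
  -- slices.
  have h1 : ((g q).toBlocks₁₁ *ᵥ fun k => J q (Sum.inl k) (Sum.inr b)) j =
      ∑ a, g q (Sum.inr a) (Sum.inr b) * J q (Sum.inr a) (Sum.inl j) := by
    refine (congrFun₂ (transpose_metric_mul_block12 hsys hA hq) b j).trans ?_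
    rw [Matrix.mul_apply]
    exact Finset.sum_congr rfl fun a _ => congrArg (· * J q (Sum.inr a) (Sum.inl j))
      (hsys.cofactor.metric.apply_symm hq (Sum.inr b) (Sum.inr a))
  -- The contraction over the driven index makes the Christoffel terms of the two factors cancel.
  have h2 : ∑ a, (∑ c, J q (Sum.inl i) (Sum.inr c) *
        christoffel g q (Sum.inr c) (Sum.inr a) (Sum.inr b)) * J q (Sum.inr a) (Sum.inl j) =
      ∑ a, J q (Sum.inl i) (Sum.inr a) * ∑ c,
        christoffel g q (Sum.inr a) (Sum.inr c) (Sum.inr b) * J q (Sum.inr c) (Sum.inl j) := by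
    simp only [Finset.sum_mul, Finset.mul_sum]
    rw [Finset.sum_comm]
    exact Finset.sum_congr rfl fun _ _ => Finset.sum_congr rfl fun _ _ => by ring
  rw [h1]
  simp only [add_mul, mul_add, Finset.sum_add_distrib, h2, mul_neg, Finset.sum_neg_distrib,
    mul_ite, mul_zero, Finset.sum_ite_eq', Finset.mem_univ, if_true, Finset.mul_sum]
  have h3 : ∀ a, 1 / 2 * (((g q).toBlocks₁₁⁻¹ *ᵥ (θ ∘ Sum.inl)) i * g q (Sum.inr a) (Sum.inr b)) *
      J q (Sum.inr a) (Sum.inl j) = 1 / 2 * (((g q).toBlocks₁₁⁻¹ *ᵥ (θ ∘ Sum.inl)) i *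
        (g q (Sum.inr a) (Sum.inr b) * J q (Sum.inr a) (Sum.inl j))) := fun a => by ring
  simp only [h3]
  ring

end Killing

lemma IsDrivenCofactorSystem.sode_inl (hsys : IsDrivenCofactorSystem U g μ J K)
    (hA : IsAdapted U g K) (hU : IsOpen U) {q : Fin m ⊕ Fin n → ℝ} (hq : q ∈ U) (i : Fin m)
    (v : Fin m → ℝ) (w : Fin n → ℝ) : sode g μ (Sum.inl i) q (Sum.elim v w) =
      -(∑ j, ∑ k, christoffel g q (Sum.inl i) (Sum.inl j) (Sum.inl k) * v j * v k) +
        ((g q).toBlocks₁₁⁻¹ *ᵥ fun j => μ q (Sum.inl j)) i := by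
  have hz : ∀ j a, christoffel g q (Sum.inl i) (Sum.inl j) (Sum.inr a) = 0 := fun j a =>
    (hsys.cofactor.metric.christoffel_symm hU hq _ _ _).trans
      (hsys.christoffel_inl_inr hA hU hq i a _)
  rw [sode, hA.inv_metric_eq_fromBlocks hsys.cofactor.metric hq]
  simp [Fintype.sum_sum_type, hz, hsys.christoffel_inl_inr hA hU hq, Matrix.mulVec, dotProduct]

end AdaptedTensor

/-! ### The driving motion and the evolution of the modified momenta. -/

section DrivingCurve

open Matrix Filter Topology

variable {m n : ℕ} {U : Set (Fin m ⊕ Fin n → ℝ)}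
  {g : (Fin m ⊕ Fin n → ℝ) → Matrix (Fin m ⊕ Fin n) (Fin m ⊕ Fin n) ℝ}
  {μ : (Fin m ⊕ Fin n → ℝ) → Fin m ⊕ Fin n → ℝ}
  {J : (Fin m ⊕ Fin n → ℝ) → Matrix (Fin m ⊕ Fin n) (Fin m ⊕ Fin n) ℝ}
  {K : (Fin m ⊕ Fin n → ℝ) → (Fin m ⊕ Fin n → ℝ) → Submodule ℝ (Fin m ⊕ Fin n → ℝ)}

lemma block11_eq_of_slice (hsys : IsDrivenCofactorSystem U g μ J K) (hA : IsAdapted U g K)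
    (hU : IsOpen U) {y : Fin m → ℝ}
    (hslice : IsPreconnected {x : Fin n → ℝ | Sum.elim y x ∈ U}) {x x' : Fin n → ℝ}
    (hx : Sum.elim y x ∈ U) (hx' : Sum.elim y x' ∈ U) :
    (J (Sum.elim y x)).toBlocks₁₁ = (J (Sum.elim y x')).toBlocks₁₁ := by
  obtain ⟨θ, hθ⟩ := hsys.cofactor.scKt.killing
  ext i j
  exact eq_of_pd_inr_eq_zero hU hslice (φ := fun q => J q (Sum.inl i) (Sum.inl j))
    (fun x hx => differentiableAt_of_contDiffOn hU (hsys.cofactor.scKt.smooth _ _) hx)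
    (fun x hx a => pd_inr_block11 hsys hA hU hx (hθ _ hx) a i j) hx hx'

lemma metric11_eq_of_slice (hsys : IsDrivenCofactorSystem U g μ J K) (hA : IsAdapted U g K)
    (hU : IsOpen U) {y : Fin m → ℝ}
    (hslice : IsPreconnected {x : Fin n → ℝ | Sum.elim y x ∈ U}) {x x' : Fin n → ℝ}
    (hx : Sum.elim y x ∈ U) (hx' : Sum.elim y x' ∈ U) :
    (g (Sum.elim y x)).toBlocks₁₁ = (g (Sum.elim y x')).toBlocks₁₁ := by
  ext i j
  exact eq_of_pd_inr_eq_zero hU hslice (φ := fun q => g q (Sum.inl i) (Sum.inl j))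
    (fun x hx => differentiableAt_of_contDiffOn hU (hsys.cofactor.metric.smooth _ _) hx)
    (fun x hx a => hsys.pd_inr_metric hA hU hx a i j) hx hx'

lemma sode_inl_eq_of_slice (hsys : IsDrivenCofactorSystem U g μ J K) (hA : IsAdapted U g K)
    (hU : IsOpen U) {y : Fin m → ℝ}
    (hslice : IsPreconnected {x : Fin n → ℝ | Sum.elim y x ∈ U}) {x x' : Fin n → ℝ}
    (hx : Sum.elim y x ∈ U) (hx' : Sum.elim y x' ∈ U) (i : Fin m) (v : Fin m → ℝ)
    (w w' : Fin n → ℝ) : sode g μ (Sum.inl i) (Sum.elim y x) (Sum.elim v w) =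
      sode g μ (Sum.inl i) (Sum.elim y x') (Sum.elim v w') := by
  -- The closed form does not involve the driven velocity, so `w'` may be traded for `w` at the same
  -- point.
  rw [hsys.sode_inl hA hU hx' i v w', ← hsys.sode_inl hA hU hx' i v w]
  exact eq_of_pd_inr_eq_zero hU hslice
    (φ := fun q => sode g μ (Sum.inl i) q (Sum.elim v w))
    (fun x hx => differentiableAt_sode hsys.cofactor.metric hU hsys.cofactor.smooth_force hx _ _)
    (fun x hx a => hsys.pd_inr_sode hA hU hx a i _) hx hx'

/-- The driving equations and the definition of the modified momenta, at all points of the slice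
over `y(t)`. -/
structure IsDrivingMotion (U : Set (Fin m ⊕ Fin n → ℝ))
    (g : (Fin m ⊕ Fin n → ℝ) → Matrix (Fin m ⊕ Fin n) (Fin m ⊕ Fin n) ℝ)
    (μ : (Fin m ⊕ Fin n → ℝ) → Fin m ⊕ Fin n → ℝ)
    (J : (Fin m ⊕ Fin n → ℝ) → Matrix (Fin m ⊕ Fin n) (Fin m ⊕ Fin n) ℝ)
    (I : Set ℝ) (y ydot ptil : ℝ → Fin m → ℝ) : Prop where
  nonempty : ∀ t ∈ I, ∃ x : Fin n → ℝ, Sum.elim (y t) x ∈ U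
  deriv_y : ∀ t ∈ I, ∀ i, HasDerivAt (fun s => y s i) (ydot t i) t
  deriv_ydot : ∀ t ∈ I, ∀ x, Sum.elim (y t) x ∈ U → ∀ i, HasDerivAt (fun s => ydot s i)
    (sode g μ (Sum.inl i) (Sum.elim (y t) x) (Sum.elim (ydot t) 0)) t
  momenta : ∀ t ∈ I, ∀ x, Sum.elim (y t) x ∈ U →
    (g (Sum.elim (y t) x)).toBlocks₁₁ *ᵥ ydot t = (J (Sum.elim (y t) x)).toBlocks₁₁ᵀ *ᵥ ptil t

lemma IsDrivingSolution.exists_isDrivingMotion (hsys : IsDrivenCofactorSystem U g μ J K)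
    (hA : IsAdapted U g K) (hU : IsOpen U)
    (hslice : ∀ y : Fin m → ℝ, IsPreconnected {x : Fin n → ℝ | Sum.elim y x ∈ U})
    {I : Set ℝ} {y ptil : ℝ → Fin m → ℝ} (hy : IsDrivingSolution U g μ J I y ptil) :
    ∃ ydot, IsDrivingMotion U g μ J I y ydot ptil := by
  obtain ⟨ydot, h⟩ := hy
  refine ⟨ydot, fun t ht => ?_, fun t ht => (h t ht).1, fun t ht x hx i => ?_,
    fun t ht x hx => ?_⟩
  · obtain ⟨-, x, -, hx, -⟩ := h t ht
    exact ⟨x, hx⟩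
  · obtain ⟨-, x', w, hx', h1, -⟩ := h t ht
    rw [sode_inl_eq_of_slice hsys hA hU (hslice _) hx hx' i (ydot t) 0 w]
    exact h1 i
  · obtain ⟨-, x', w, hx', -, h2⟩ := h t ht
    rw [block11_eq_of_slice hsys hA hU (hslice _) hx hx',
      metric11_eq_of_slice hsys hA hU (hslice _) hx hx']
    ext i
    exact h2 i

section Motion

variable {I : Set ℝ} {y ydot ptil : ℝ → Fin m → ℝ}

lemma IsDrivingMotion.eventually_mem (hy : IsDrivingMotion U g μ J I y ydot ptil)
    (hU : IsOpen U) (hI : IsOpen I) {t : ℝ} (ht : t ∈ I) {x : Fin n → ℝ}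
    (hx : Sum.elim (y t) x ∈ U) : ∀ᶠ s in 𝓝 t, s ∈ I ∧ Sum.elim (y s) x ∈ U := by
  have hc : ContinuousAt (fun s => (Sum.elim (y s) x : Fin m ⊕ Fin n → ℝ)) t := by
    rw [continuousAt_pi]
    rintro (i | a)
    · exact (hy.deriv_y t ht i).continuousAt
    · exact continuousAt_const
  exact (hI.eventually_mem ht).and (hc.eventually_mem (hU.mem_nhds hx))

/-- Differentiability of `ptil` follows by solving `p_i = J^j_i ptil_j` with a fixed `x`, which
remains in the slice for nearby times. -/
lemma IsDrivingMotion.differentiableAt_ptil (hy : IsDrivingMotion U g μ J I y ydot ptil)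
    (hsys : IsDrivenCofactorSystem U g μ J K) (hU : IsOpen U) (hI : IsOpen I)
    (hJ1 : ∀ q ∈ U, (J q).toBlocks₁₁.det ≠ 0) {t : ℝ} (ht : t ∈ I) (j : Fin m) :
    DifferentiableAt ℝ (fun s => ptil s j) t := by
  obtain ⟨x, hx⟩ := hy.nonempty t ht
  have hev : (fun s => ptil s j) =ᶠ[𝓝 t] fun s => ∑ i,
      ((J (Sum.elim (y s) x)).toBlocks₁₁)⁻¹ i j *
        ∑ k, g (Sum.elim (y s) x) (Sum.inl i) (Sum.inl k) * ydot s k := by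
    filter_upwards [hy.eventually_mem hU hI ht hx] with s hs
    have h := congrArg (fun z => (J (Sum.elim (y s) x)).toBlocks₁₁ᵀ⁻¹ *ᵥ z)
      (hy.momenta s hs.1 x hs.2)
    simp only [Matrix.mulVec_mulVec] at h
    rw [Matrix.nonsing_inv_mul _ (by
      rw [Matrix.det_transpose]; exact isUnit_iff_ne_zero.mpr (hJ1 _ hs.2)), Matrix.one_mulVec,
      ← Matrix.mulVec_mulVec, ← Matrix.transpose_nonsing_inv] at h
    exact (congrFun h j).symm
  refine DifferentiableAt.congr_of_eventuallyEq (DifferentiableAt.fun_sum fun i _ => ?_) hev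
  refine DifferentiableAt.mul
    (differentiableAt_inv (M := fun s => (J (Sum.elim (y s) x)).toBlocks₁₁) (fun k l => ?_) (hJ1 _ hx) i j)
    (DifferentiableAt.fun_sum fun k _ => ?_)
  · exact (hasDerivAt_comp_sumElim_left (φ := fun q => J q (Sum.inl k) (Sum.inl l))
      (differentiableAt_of_contDiffOn hU (hsys.cofactor.scKt.smooth _ _) hx)
      (hy.deriv_y t ht)).differentiableAt
  · exact (hasDerivAt_comp_sumElim_left (φ := fun q => g q (Sum.inl i) (Sum.inl k))
      (differentiableAt_of_contDiffOn hU (hsys.cofactor.metric.smooth _ _) hx)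
      (hy.deriv_y t ht)).differentiableAt.mul (hy.deriv_ydot t ht x hx k).differentiableAt

/-- The connection matrix `Γ^i_{lk} ẏ^k` along the driving motion. -/
noncomputable def driftMat (g : (Fin m ⊕ Fin n → ℝ) → Matrix (Fin m ⊕ Fin n) (Fin m ⊕ Fin n) ℝ)
    (q : Fin m ⊕ Fin n → ℝ) (v : Fin m → ℝ) : Matrix (Fin m) (Fin m) ℝ :=
  Matrix.of fun i l => ∑ k, christoffel g q (Sum.inl i) (Sum.inl l) (Sum.inl k) * v k

/-- The equations of motion of the modified momenta. -/
lemma IsDrivingMotion.transpose_mulVec_deriv_ptil (hy : IsDrivingMotion U g μ J I y ydot ptil)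
    (hsys : IsDrivenCofactorSystem U g μ J K) (hA : IsAdapted U g K) (hU : IsOpen U)
    (hI : IsOpen I) (hJ1 : ∀ q ∈ U, (J q).toBlocks₁₁.det ≠ 0) {t : ℝ} (ht : t ∈ I)
    {x : Fin n → ℝ} (hx : Sum.elim (y t) x ∈ U) {θ : Fin m ⊕ Fin n → ℝ}
    (hθ : ∀ α β γ, covDerivLower g J (Sum.elim (y t) x) α β γ = (1 / 2) *
      (θ α * g (Sum.elim (y t) x) β γ + θ β * g (Sum.elim (y t) x) α γ)) :
    (J (Sum.elim (y t) x)).toBlocks₁₁ᵀ *ᵥ (fun j => deriv (fun s => ptil s j) t) =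
      (fun j => μ (Sum.elim (y t) x) (Sum.inl j)) + (J (Sum.elim (y t) x)).toBlocks₁₁ᵀ *ᵥ
        ((driftMat g (Sum.elim (y t) x) (ydot t))ᵀ *ᵥ ptil t) - (1 / 2 : ℝ) •
      ((((g (Sum.elim (y t) x)).toBlocks₁₁⁻¹ *ᵥ (θ ∘ Sum.inl)) ⬝ᵥ ptil t) •
          ((g (Sum.elim (y t) x)).toBlocks₁₁ *ᵥ ydot t) +
        (ydot t ⬝ᵥ ptil t) • (θ ∘ Sum.inl)) := by
  set q := Sum.elim (y t) x with hqdef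
  have hg := hsys.cofactor.metric
  have hu1 : IsUnit (g q).toBlocks₁₁.det := isUnit_iff_ne_zero.mpr (hA.det_metric_blocks hg hx).1
  set acc : Fin m → ℝ := fun i => sode g μ (Sum.inl i) q (Sum.elim (ydot t) 0) with hacc
  set dg : Matrix (Fin m) (Fin m) ℝ := Matrix.of fun i j =>
    ∑ k, pd (Sum.inl k) (fun q => g q (Sum.inl i) (Sum.inl j)) q * ydot t k with hdg
  set dM : Matrix (Fin m) (Fin m) ℝ := Matrix.of fun i j =>
    ∑ k, pd (Sum.inl k) (fun q => J q (Sum.inl i) (Sum.inl j)) q * ydot t k with hdM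
  refine modified_momenta_identity (J q).toBlocks₁₁ (g q).toBlocks₁₁ (driftMat g q (ydot t)) dM dg
    (θ ∘ Sum.inl) ((g q).toBlocks₁₁⁻¹ *ᵥ (θ ∘ Sum.inl)) _ (ydot t) acc (ptil t) _
    (hy.momenta t ht x hx) ?_ ?_ ?_ ?_
  · have h1 : acc = (g q).toBlocks₁₁⁻¹ *ᵥ (fun j => μ q (Sum.inl j)) -
        driftMat g q (ydot t) *ᵥ ydot t := by
      ext i
      have h2 : (driftMat g q (ydot t) *ᵥ ydot t) i =
          ∑ j, ∑ k, christoffel g q (Sum.inl i) (Sum.inl j) (Sum.inl k) * ydot t j * ydot t k := by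
        simp only [driftMat, Matrix.mulVec, dotProduct, Matrix.of_apply, Finset.sum_mul]
        exact Finset.sum_congr rfl fun _ _ => Finset.sum_congr rfl fun _ _ => by ring
      rw [Pi.sub_apply, h2]
      refine (hsys.sode_inl hA hU hx i (ydot t) 0).trans ?_
      ring
    rw [h1, Matrix.mulVec_sub, Matrix.mulVec_mulVec _ _ (g q).toBlocks₁₁⁻¹,
      Matrix.mul_nonsing_inv _ hu1, Matrix.one_mulVec]
  · ext i j
    have h : ∀ k, pd (Sum.inl k) (fun q => g q (Sum.inl i) (Sum.inl j)) q =
        (∑ l, g q (Sum.inl i) (Sum.inl l) *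
          christoffel g q (Sum.inl l) (Sum.inl j) (Sum.inl k)) +
        ∑ l, christoffel g q (Sum.inl l) (Sum.inl i) (Sum.inl k) *
          g q (Sum.inl l) (Sum.inl j) := by
      intro k
      have h0 := congrFun₂ (hg.pdMat_metric hU hx (Sum.inl k)) (Sum.inl i) (Sum.inl j)
      rw [hsys.gammaMat_inl hA hU hx] at h0
      simpa [pdMat, Matrix.mul_apply, Fintype.sum_sum_type, toBlocks₁₁, gammaMat] using h0
    simp only [hdg, h, driftMat, Matrix.of_apply, Matrix.add_apply, Matrix.mul_apply,
      Matrix.transpose_apply, toBlocks₁₁, add_mul, Finset.sum_add_distrib, Finset.sum_mul,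
      Finset.mul_sum]
    congr 1
    · rw [Finset.sum_comm]
      exact Finset.sum_congr rfl fun _ _ => Finset.sum_congr rfl fun _ _ => by ring
    · rw [Finset.sum_comm]
      exact Finset.sum_congr rfl fun _ _ => Finset.sum_congr rfl fun _ _ => by ring
  · ext i j
    simp only [hdM, pd_inl_block11 hsys hA hU hx hθ, driftMat, Matrix.of_apply, Matrix.add_apply,
      Matrix.sub_apply, Matrix.smul_apply, Matrix.mul_apply, toBlocks₁₁, add_mul, sub_mul,
      mul_add, smul_add, vecMulVec_apply, smul_eq_mul, Finset.sum_add_distrib,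
      Finset.sum_sub_distrib]
    congr 1
    · congr 1
      · simp only [Finset.sum_mul, Finset.mul_sum]
        rw [Finset.sum_comm]
        exact Finset.sum_congr rfl fun _ _ => Finset.sum_congr rfl fun _ _ => by ring
      · simp only [Finset.sum_mul]
        rw [Finset.sum_comm]
        exact Finset.sum_congr rfl fun _ _ => Finset.sum_congr rfl fun _ _ => by ring
    · congr 1
      · simp only [Matrix.mulVec, dotProduct, Matrix.of_apply]
        rw [Finset.mul_sum, Finset.mul_sum]
        exact Finset.sum_congr rfl fun _ _ => by ring
      · simp [mul_comm, mul_left_comm]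
  · have hdy := hy.deriv_y t ht
    ext i
    have hL : HasDerivAt (fun s => ((g (Sum.elim (y s) x)).toBlocks₁₁ *ᵥ ydot s) i)
        ((dg *ᵥ ydot t + (g q).toBlocks₁₁ *ᵥ acc) i) t := by
      have h1 : ∀ j, HasDerivAt
          (fun s => g (Sum.elim (y s) x) (Sum.inl i) (Sum.inl j) * ydot s j)
          (dg i j * ydot t j + g q (Sum.inl i) (Sum.inl j) * acc j) t := fun j =>
        (hasDerivAt_comp_sumElim_left (φ := fun q => g q (Sum.inl i) (Sum.inl j))
          (differentiableAt_of_contDiffOn hU (hg.smooth _ _) hx) hdy).mul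
          (hy.deriv_ydot t ht x hx j)
      have h2 := HasDerivAt.fun_sum (u := Finset.univ) fun j _ => h1 j
      rw [Finset.sum_add_distrib] at h2
      exact h2
    have hR : HasDerivAt (fun s => ((J (Sum.elim (y s) x)).toBlocks₁₁ᵀ *ᵥ ptil s) i)
        ((dMᵀ *ᵥ ptil t + (J q).toBlocks₁₁ᵀ *ᵥ fun j => deriv (fun s => ptil s j) t) i) t := by
      have h1 : ∀ j, HasDerivAt
          (fun s => J (Sum.elim (y s) x) (Sum.inl j) (Sum.inl i) * ptil s j)
          (dM j i * ptil t j + J q (Sum.inl j) (Sum.inl i) * deriv (fun s => ptil s j) t) t :=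
        fun j => (hasDerivAt_comp_sumElim_left (φ := fun q => J q (Sum.inl j) (Sum.inl i))
          (differentiableAt_of_contDiffOn hU (hsys.cofactor.scKt.smooth _ _) hx) hdy).mul
          (hy.differentiableAt_ptil hsys hU hI hJ1 ht j).hasDerivAt
      have h2 := HasDerivAt.fun_sum (u := Finset.univ) fun j _ => h1 j
      rw [Finset.sum_add_distrib] at h2
      exact h2
    -- Both sides of `p_i = J^j_i ptil_j` agree near `t`, so their derivatives coincide.
    refine hL.unique (hR.congr_of_eventuallyEq ?_)
    filter_upwards [hy.eventually_mem hU hI ht hx] with s hs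
    exact congrFun (hy.momenta s hs.1 x hs.2) i

end Motion

end DrivingCurve

/-! ### Partial derivatives bundled with differentiability. -/

section HasPartial

variable {ι : Type} [Fintype ι] [DecidableEq ι]

/-- `F` is differentiable at `q`, with partial derivative `F'` in the direction `α`. -/
structure HasPd (α : ι) (F : (ι → ℝ) → ℝ) (F' : ℝ) (q : ι → ℝ) : Prop where
  differentiableAt : DifferentiableAt ℝ F q
  pd_eq : pd α F q = F'

variable {α : ι} {F G : (ι → ℝ) → ℝ} {F' G' : ℝ} {q : ι → ℝ}

lemma hasPd_of_contDiffOn {U : Set (ι → ℝ)} (hU : IsOpen U) (hF : ContDiffOn ℝ ∞ F U)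
    (hq : q ∈ U) (h : pd α F q = F') : HasPd α F F' q :=
  ⟨differentiableAt_of_contDiffOn hU hF hq, h⟩

lemma HasPd.add (hF : HasPd α F F' q) (hG : HasPd α G G' q) :
    HasPd α (fun q => F q + G q) (F' + G') q :=
  ⟨hF.1.add hG.1, by rw [pd_add hF.1 hG.1, hF.2, hG.2]⟩

lemma HasPd.sub (hF : HasPd α F F' q) (hG : HasPd α G G' q) :
    HasPd α (fun q => F q - G q) (F' - G') q :=
  ⟨hF.1.sub hG.1, by rw [pd_sub hF.1 hG.1, hF.2, hG.2]⟩

lemma HasPd.const_mul (c : ℝ) (hF : HasPd α F F' q) : HasPd α (fun q => c * F q) (c * F') q :=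
  ⟨hF.1.const_mul c, by rw [pd_const_mul c hF.1, hF.2]⟩

lemma HasPd.mul_const (hF : HasPd α F F' q) (c : ℝ) : HasPd α (fun q => F q * c) (F' * c) q :=
  ⟨hF.1.mul_const c, by rw [pd_mul_const c hF.1, hF.2]⟩

lemma HasPd.sub_const (hF : HasPd α F F' q) (c : ℝ) : HasPd α (fun q => F q - c) F' q := by
  simpa using hF.sub (G := fun _ => c) ⟨differentiableAt_const c, pd_const c α q⟩

lemma HasPd.sum {κ : Type*} [Fintype κ] {F : κ → (ι → ℝ) → ℝ} {F' : κ → ℝ}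
    (hF : ∀ k, HasPd α (F k) (F' k) q) : HasPd α (fun q => ∑ k, F k q) (∑ k, F' k) q :=
  ⟨DifferentiableAt.fun_sum fun k _ => (hF k).1, by
    rw [pd_sum fun k _ => (hF k).1]
    exact Finset.sum_congr rfl fun k _ => (hF k).2⟩

end HasPartial

/-! ### Vanishing of the driven derivatives of the residual. -/

section Residual

open Matrix

variable {m n : ℕ} {U : Set (Fin m ⊕ Fin n → ℝ)}
  {g : (Fin m ⊕ Fin n → ℝ) → Matrix (Fin m ⊕ Fin n) (Fin m ⊕ Fin n) ℝ}
  {μ : (Fin m ⊕ Fin n → ℝ) → Fin m ⊕ Fin n → ℝ}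
  {J : (Fin m ⊕ Fin n → ℝ) → Matrix (Fin m ⊕ Fin n) (Fin m ⊕ Fin n) ℝ}
  {K : (Fin m ⊕ Fin n → ℝ) → (Fin m ⊕ Fin n → ℝ) → Submodule ℝ (Fin m ⊕ Fin n → ℝ)}
  {W V : (Fin m ⊕ Fin n → ℝ) → ℝ} {ψ : Fin m → (Fin m ⊕ Fin n → ℝ) → ℝ}
  {I : Set ℝ} {y ydot ptil : ℝ → Fin m → ℝ}

/-- The tensor `A_(n)` in blocks. -/
lemma cofA_eq (J : (Fin m ⊕ Fin n → ℝ) → Matrix (Fin m ⊕ Fin n) (Fin m ⊕ Fin n) ℝ)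
    {q : Fin m ⊕ Fin n → ℝ} (h : (J q).toBlocks₁₁.det ≠ 0) (hn : 0 < n) :
    cofA J n q = (J q).toBlocks₁₁.det • fromBlocks
      (((J q).toBlocks₂₂ - (J q).toBlocks₂₁ * (J q).toBlocks₁₁⁻¹ * (J q).toBlocks₁₂).trace •
        (J q).toBlocks₁₁⁻¹ +
        (J q).toBlocks₁₁⁻¹ * (J q).toBlocks₁₂ * (J q).toBlocks₂₁ * (J q).toBlocks₁₁⁻¹)
      (-((J q).toBlocks₁₁⁻¹ * (J q).toBlocks₁₂)) (-((J q).toBlocks₂₁ * (J q).toBlocks₁₁⁻¹)) 1 := by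
  rw [cofA, ← cofCoeff_projK _ _ _ _ h hn, fromBlocks_toBlocks]

/-- Only the driven block column of `A_(n)` enters, so neither the trace of the Schur complement nor
`B D` appears. -/
lemma pd_inr_potentialW (hW : IsPotentialW U μ J n W) {q : Fin m ⊕ Fin n → ℝ} (hq : q ∈ U)
    (h : (J q).toBlocks₁₁.det ≠ 0) (hn : 0 < n) (b : Fin n) :
    pd (Sum.inr b) W q = (J q).toBlocks₁₁.det * ((fun i => μ q (Sum.inl i)) ⬝ᵥ
      ((J q).toBlocks₁₁⁻¹ *ᵥ fun i => J q (Sum.inl i) (Sum.inr b)) - μ q (Sum.inr b)) := by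
  have h1 := hW.deriv_eq q hq (Sum.inr b)
  rw [cofA_eq J h hn, Fintype.sum_sum_type] at h1
  have h2 : ∀ i, ((J q).toBlocks₁₁⁻¹ * (J q).toBlocks₁₂) i b =
      ((J q).toBlocks₁₁⁻¹ *ᵥ fun i => J q (Sum.inl i) (Sum.inr b)) i := fun i => rfl
  simp only [Matrix.smul_apply, fromBlocks_apply₁₂, fromBlocks_apply₂₂, Matrix.neg_apply, h2,
    smul_eq_mul, Matrix.one_apply, mul_ite, mul_one, mul_zero, ite_mul, zero_mul,
    Finset.sum_ite_eq', Finset.mem_univ, if_true] at h1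
  rw [dotProduct, mul_sub, Finset.mul_sum]
  have h3 : ∑ i, (J q).toBlocks₁₁.det * -(((J q).toBlocks₁₁⁻¹ *ᵥ fun i =>
        J q (Sum.inl i) (Sum.inr b)) i) * μ q (Sum.inl i) =
      -∑ i, (J q).toBlocks₁₁.det * (μ q (Sum.inl i) * ((J q).toBlocks₁₁⁻¹ *ᵥ fun i =>
        J q (Sum.inl i) (Sum.inr b)) i) := by
    rw [← Finset.sum_neg_distrib]
    exact Finset.sum_congr rfl fun _ _ => by ring
  rw [h3] at h1
  linarith

/-- The part of `h + ∂F/∂t - (det J_1)⁻¹ H_(n) - J^{ai} P_a ptil_i` that survives the cancellation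
of the kinetic terms, as a function on a slice; the quantities that are constant on the slice are
parameters. -/
noncomputable def residual
    (J : (Fin m ⊕ Fin n → ℝ) → Matrix (Fin m ⊕ Fin n) (Fin m ⊕ Fin n) ℝ)
    (W V : (Fin m ⊕ Fin n → ℝ) → ℝ) (ψ : Fin m → (Fin m ⊕ Fin n → ℝ) → ℝ)
    (M : Matrix (Fin m) (Fin m) ℝ) (v pt pt' r : Fin m → ℝ) (q : Fin m ⊕ Fin n → ℝ) : ℝ :=
  V q - M.det⁻¹ * W q + ∑ i, ((∑ j, pd (Sum.inl j) (ψ i) q * v j) * pt i + ψ i q * pt' i) -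
    (1 / 2) * ((J q).trace - M.trace - ∑ i, ∑ j, M⁻¹ i j *
      ∑ a, J q (Sum.inl j) (Sum.inr a) * J q (Sum.inr a) (Sum.inl i)) * (v ⬝ᵥ pt) +
    (1 / 2) * ∑ i, pt i * ∑ j,
      (∑ a, J q (Sum.inl i) (Sum.inr a) * J q (Sum.inr a) (Sum.inl j)) * r j

lemma IsDrivingMotion.pd_inr_residual (hy : IsDrivingMotion U g μ J I y ydot ptil)
    (hsys : IsDrivenCofactorSystem U g μ J K) (hA : IsAdapted U g K) (hU : IsOpen U)
    (hI : IsOpen I) (hJ1 : ∀ q ∈ U, (J q).toBlocks₁₁.det ≠ 0)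
    (hW : IsPotentialW U μ J n W) (hV : IsDrivenPotential U μ V) (hψ : IsPsi U J ψ)
    {t : ℝ} (ht : t ∈ I) {x : Fin n → ℝ} (hx : Sum.elim (y t) x ∈ U) (b : Fin n)
    {M : Matrix (Fin m) (Fin m) ℝ} {r : Fin m → ℝ}
    (hM : (J (Sum.elim (y t) x)).toBlocks₁₁ = M)
    (hr : (g (Sum.elim (y t) x)).toBlocks₁₁ *ᵥ r = ptil t) :
    HasPd (Sum.inr b) (residual J W V ψ M (ydot t) (ptil t)
      (fun j => deriv (fun s => ptil s j) t) r) 0 (Sum.elim (y t) x) := by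
  obtain ⟨θ', hθ'⟩ := hsys.cofactor.scKt.killing
  have hn := hsys.pos_of_isAdapted hA
  set q := Sum.elim (y t) x with hqdef
  set θ := θ' q with hθdef
  have hθ := hθ' q hx
  have hg := hsys.cofactor.metric
  have hu1 : IsUnit (g q).toBlocks₁₁.det := isUnit_iff_ne_zero.mpr (hA.det_metric_blocks hg hx).1
  have hJs := hsys.cofactor.scKt.smooth
  set bv : Fin m → ℝ := fun i => J q (Sum.inl i) (Sum.inr b) with hbv
  set θs := (g q).toBlocks₁₁⁻¹ *ᵥ (θ ∘ Sum.inl) with hθs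
  set dBD : Matrix (Fin m) (Fin m) ℝ := Matrix.of fun i j =>
    (1 / 2) * (θs i * ((g q).toBlocks₁₁ *ᵥ bv) j + bv i * θ (Sum.inl j)) with hdBD
  set v := ydot t with hv
  set pt := ptil t with hpt
  set pt' : Fin m → ℝ := fun j => deriv (fun s => ptil s j) t with hpt'
  have cancel := energy_cancellation M (g q).toBlocks₁₁ (driftMat g q v) dBD (θ ∘ Sum.inl) θs
    (fun j => μ q (Sum.inl j)) v bv pt pt' r (θ (Sum.inr b))
    (by rw [← hM]; exact hJ1 q hx)
    (by rw [← hM]; exact transpose_metric_mul_block11 hsys hA hx)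
    (by ext i j; exact hg.apply_symm hx _ _)
    (by rw [hθs, Matrix.mulVec_mulVec, Matrix.mul_nonsing_inv _ hu1, Matrix.one_mulVec])
    hr (by rw [← hM]; exact hy.momenta t ht x hx)
    (by rw [← hM]; exact hy.transpose_mulVec_deriv_ptil hsys hA hU hI hJ1 ht hx hθ)
    (by ext i j; simp [hdBD, vecMulVec_apply])
  have hBD : ∀ i j, HasPd (Sum.inr b)
      (fun q => ∑ a, J q (Sum.inl i) (Sum.inr a) * J q (Sum.inr a) (Sum.inl j)) (dBD i j) q :=
    fun i j => ⟨DifferentiableAt.fun_sum fun a _ =>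
      (differentiableAt_of_contDiffOn hU (hJs _ _) hx).mul
        (differentiableAt_of_contDiffOn hU (hJs _ _) hx),
      pd_inr_block12_mul_block21 hsys hA hU hx hθ b i j⟩
  have hdV : HasPd (Sum.inr b) V (-μ q (Sum.inr b)) q :=
    hasPd_of_contDiffOn hU hV.smooth hx (by rw [hV.deriv_eq q hx b, neg_neg])
  have hdW := hasPd_of_contDiffOn hU hW.smooth hx
    (pd_inr_potentialW hW hx (hJ1 q hx) hn b)
  have htr : HasPd (Sum.inr b) (fun q => (J q).trace) (θ (Sum.inr b)) q := by
    refine ⟨?_, pd_trace_of_killing hg hU hJs hx hθ _⟩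
    exact DifferentiableAt.fun_sum fun α _ => differentiableAt_of_contDiffOn hU (hJs α α) hx
  have hdψ : ∀ i, HasPd (Sum.inr b) (ψ i) (bv i) q := fun i =>
    hasPd_of_contDiffOn hU (hψ.smooth i) hx (hψ.deriv_eq q hx i b).symm
  have hddψ : ∀ i j, HasPd (Sum.inr b) (pd (Sum.inl j) (ψ i))
      (-(∑ l, christoffel g q (Sum.inl i) (Sum.inl l) (Sum.inl j) * bv l) +
        (1 / 2) * if i = j then θ (Sum.inr b) else 0) q := by
    intro i j
    refine hasPd_of_contDiffOn hU (contDiffOn_pd hU (hψ.smooth i) _) hx ?_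
    -- Interchanging the derivatives turns `∂ψ^i/∂x^b` into `J^i_b`, to which the Killing equation
    -- applies.
    rw [pd_comm hU (hψ.smooth i) hx, ← pd_inl_block12 hsys hA hU hx hθ j i b]
    exact pd_congr_on hU (fun q hq => (hψ.deriv_eq q hq i b).symm) hx _
  -- The combination follows the shape of `residual` term by term, so that the function obtained is
  -- `residual` by definition.
  have main := (((hdV.sub (hdW.const_mul M.det⁻¹)).add (HasPd.sum fun i =>
    ((HasPd.sum fun j => (hddψ i j).mul_const (v j)).mul_const (pt i)).add
      ((hdψ i).mul_const (pt' i)))).sub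
    ((((htr.sub_const M.trace).sub (HasPd.sum fun i => HasPd.sum fun j =>
      (hBD j i).const_mul (M⁻¹ i j))).const_mul (1 / 2)).mul_const (v ⬝ᵥ pt))).add
    ((HasPd.sum fun i => (HasPd.sum fun j => (hBD i j).mul_const (r j)).const_mul (pt i)).const_mul
      (1 / 2))
  refine ⟨main.1, main.2.trans (Eq.trans ?_ cancel)⟩
  have hd0 : M.det ≠ 0 := by rw [← hM]; exact hJ1 q hx
  have e1 : ∑ i, ((∑ j, (-(∑ l, christoffel g q (Sum.inl i) (Sum.inl l) (Sum.inl j) * bv l) +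
      (1 / 2) * if i = j then θ (Sum.inr b) else 0) * v j) * pt i + bv i * pt' i) =
      (-((driftMat g q v *ᵥ bv) ⬝ᵥ pt) + (1 / 2) * θ (Sum.inr b) * (v ⬝ᵥ pt)) + bv ⬝ᵥ pt' := by
    have f1 : ∀ i, ∑ j, (∑ l, christoffel g q (Sum.inl i) (Sum.inl l) (Sum.inl j) * bv l) * v j =
        (driftMat g q v *ᵥ bv) i := by
      intro i
      simp only [driftMat, Matrix.mulVec, dotProduct, Matrix.of_apply, Finset.sum_mul]
      rw [Finset.sum_comm]
      exact Finset.sum_congr rfl fun _ _ => Finset.sum_congr rfl fun _ _ => by ring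
    simp only [add_mul, neg_mul, Finset.sum_add_distrib, Finset.sum_neg_distrib, f1, mul_ite,
      mul_zero, ite_mul, zero_mul, Finset.sum_ite_eq, Finset.mem_univ, if_true, dotProduct,
      Finset.mul_sum]
    simp only [mul_assoc]
  have e2 : ∑ i, ∑ j, M⁻¹ i j * dBD j i = (M⁻¹ * dBD).trace := rfl
  have e3 : ∑ i, pt i * ∑ j, dBD i j * r j = pt ⬝ᵥ (dBD *ᵥ r) := rfl
  rw [e1, e2, e3, hM, inv_mul_cancel_left₀ hd0]
  ring

end Residual

/-! ### The canonical transformation and the new Hamiltonian. -/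

section Transformation

open Matrix

variable {m n : ℕ} {U : Set (Fin m ⊕ Fin n → ℝ)}
  {g : (Fin m ⊕ Fin n → ℝ) → Matrix (Fin m ⊕ Fin n) (Fin m ⊕ Fin n) ℝ}
  {μ : (Fin m ⊕ Fin n → ℝ) → Fin m ⊕ Fin n → ℝ}
  {J : (Fin m ⊕ Fin n → ℝ) → Matrix (Fin m ⊕ Fin n) (Fin m ⊕ Fin n) ℝ}
  {K : (Fin m ⊕ Fin n → ℝ) → (Fin m ⊕ Fin n → ℝ) → Submodule ℝ (Fin m ⊕ Fin n → ℝ)}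
  {W V : (Fin m ⊕ Fin n → ℝ) → ℝ} {ψ : Fin m → (Fin m ⊕ Fin n → ℝ) → ℝ}
  {I : Set ℝ} {y ydot ptil : ℝ → Fin m → ℝ}

/-- The canonical transformation generated by `F`. -/
lemma genRel_genF_iff (hU : IsOpen U) (hψ : IsPsi U J ψ) {t : ℝ} {x p X P : Fin n → ℝ}
    (hx : Sum.elim (y t) x ∈ U) : GenRel (genF ψ y ptil) t x p X P ↔
      X = x ∧ ∀ a, p a = P a +
        ∑ i, J (Sum.elim (y t) x) (Sum.inl i) (Sum.inr a) * ptil t i := by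
  have hp : ∀ a, HasDerivAt (fun s => genF ψ y ptil (Function.update x a s) P t)
      (P a + ∑ i, J (Sum.elim (y t) x) (Sum.inl i) (Sum.inr a) * ptil t i) (x a) := by
    intro a
    refine HasDerivAt.add ?_ (HasDerivAt.fun_sum fun i _ => ?_)
    · have h : ∀ b, HasDerivAt (fun s => Function.update x a s b * P b)
          ((if b = a then 1 else 0) * P b) (x a) := by
        intro b
        refine HasDerivAt.mul_const ?_ _
        simp only [Function.update_apply]
        split_ifs
        · exact hasDerivAt_id' _
        · exact hasDerivAt_const _ _
      simpa using HasDerivAt.fun_sum (u := Finset.univ) fun b _ => h b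
    · rw [hψ.deriv_eq _ hx]
      exact (hasDerivAt_comp_sumElim_update
        (differentiableAt_of_contDiffOn hU (hψ.smooth i) hx) a).mul_const _
  have hX : ∀ a, HasDerivAt (fun s => genF ψ y ptil x (Function.update P a s) t) (x a) (P a) := by
    intro a
    refine HasDerivAt.add_const _ ?_
    have h : ∀ b, HasDerivAt (fun s => x b * Function.update P a s b)
        (x b * (if b = a then 1 else 0)) (P a) := by
      intro b
      refine HasDerivAt.const_mul _ ?_
      simp only [Function.update_apply]
      split_ifs
      · exact hasDerivAt_id' _
      · exact hasDerivAt_const _ _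
    simpa using HasDerivAt.fun_sum (u := Finset.univ) fun b _ => h b
  constructor
  · rintro ⟨h1, h2⟩
    exact ⟨funext fun a => (h2 a).unique (hX a), fun a => (h1 a).unique (hp a)⟩
  · rintro ⟨rfl, h2⟩
    exact ⟨fun a => by rw [h2 a]; exact hp a, hX⟩

lemma sum_sum_mul_eq_dotProduct {κ l : Type*} [Fintype κ] [Fintype l] (A : Matrix κ l ℝ)
    (p : κ → ℝ) (r : l → ℝ) : ∑ i, ∑ j, A i j * p i * r j = p ⬝ᵥ (A *ᵥ r) := by
  simp only [dotProduct, Matrix.mulVec, Finset.mul_sum]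
  exact Finset.sum_congr rfl fun _ _ => Finset.sum_congr rfl fun _ _ => by ring

/-- The new Hamiltonian, up to a function of time, at a point. -/
lemma IsDrivingMotion.transformed_hamiltonian (hy : IsDrivingMotion U g μ J I y ydot ptil)
    (hsys : IsDrivenCofactorSystem U g μ J K) (hA : IsAdapted U g K)
    (hJ1 : ∀ q ∈ U, (J q).toBlocks₁₁.det ≠ 0) {t : ℝ} (ht : t ∈ I) {x p P : Fin n → ℝ}
    (hx : Sum.elim (y t) x ∈ U)
    (hp : ∀ a, p a = P a + ∑ i, J (Sum.elim (y t) x) (Sum.inl i) (Sum.inr a) * ptil t i)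
    (pt' : Fin m → ℝ) :
    ((J (Sum.elim (y t) x)).toBlocks₁₁.det)⁻¹ * quadHam g (cofA J n) W (Sum.elim (y t) x)
          (oldMomenta (J (Sum.elim (y t) x)) (ptil t) P) +
        (∑ a, ∑ i, (J (Sum.elim (y t) x) * (g (Sum.elim (y t) x))⁻¹) (Sum.inr a) (Sum.inl i) *
          P a * ptil t i) +
        residual J W V ψ (J (Sum.elim (y t) x)).toBlocks₁₁ (ydot t) (ptil t) pt'
          ((g (Sum.elim (y t) x)).toBlocks₁₁⁻¹ *ᵥ ptil t) (Sum.elim (y t) x) =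
      drivenHam g V y x p t + ∑ i, ((∑ j, pd (Sum.inl j) (ψ i) (Sum.elim (y t) x) * ydot t j) *
        ptil t i + ψ i (Sum.elim (y t) x) * pt' i) := by
  set q := Sum.elim (y t) x with hq
  have hn := hsys.pos_of_isAdapted hA
  have hg := hsys.cofactor.metric
  obtain ⟨hg1, hg2⟩ := hA.det_metric_blocks hg hx
  set τ := ((J q).toBlocks₂₂ - (J q).toBlocks₂₁ * (J q).toBlocks₁₁⁻¹ * (J q).toBlocks₁₂).trace
    with hτ
  have kin := kinetic_identity (J q).toBlocks₁₁ (g q).toBlocks₁₁ (J q).toBlocks₁₂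
    (J q).toBlocks₂₁ (g q).toBlocks₂₂ (hJ1 q hx) hg1 hg2
    (by ext i j; exact hg.apply_symm hx _ _) (by ext i j; exact hg.apply_symm hx _ _)
    (transpose_metric_mul_block11 hsys hA hx) (transpose_metric_mul_block12 hsys hA hx) τ
    (ptil t) (ydot t) P (hy.momenta t ht x hx)
  have hold : oldMomenta (J q) (ptil t) P =
      Sum.elim ((J q).toBlocks₁₁ᵀ *ᵥ ptil t) (P + (J q).toBlocks₁₂ᵀ *ᵥ ptil t) := rfl
  have hpe : p = P + (J q).toBlocks₁₂ᵀ *ᵥ ptil t := funext hp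
  have hcross : ∀ a i, (J q * (g q)⁻¹) (Sum.inr a) (Sum.inl i) =
      ((J q).toBlocks₂₁ * (g q).toBlocks₁₁⁻¹) a i := by
    intro a i
    rw [hA.inv_metric_eq_fromBlocks hg hx, Matrix.mul_apply, Fintype.sum_sum_type]
    simp [Matrix.mul_apply, toBlocks₂₁]
  have hdr : drivenHam g V y x p t = (1 / 2) * (p ⬝ᵥ ((g q).toBlocks₂₂⁻¹ *ᵥ p)) + V q := by
    rw [drivenHam, ← hq, hA.inv_metric_eq_fromBlocks hg hx]
    simp only [fromBlocks_apply₂₂]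
    rw [sum_sum_mul_eq_dotProduct]
  -- The trace of the Schur complement is expressed by quantities with known `x`-derivatives: `tr
  -- J`, `tr J1` and `B D`.
  have htr : τ = (J q).trace - (J q).toBlocks₁₁.trace - ∑ i, ∑ j, (J q).toBlocks₁₁⁻¹ i j *
      ∑ a, J q (Sum.inl j) (Sum.inr a) * J q (Sum.inr a) (Sum.inl i) := by
    have e1 : ∑ i, ∑ j, (J q).toBlocks₁₁⁻¹ i j *
        ∑ a, J q (Sum.inl j) (Sum.inr a) * J q (Sum.inr a) (Sum.inl i) =
        ((J q).toBlocks₁₁⁻¹ * ((J q).toBlocks₁₂ * (J q).toBlocks₂₁)).trace := rfl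
    have e2 : (J q).trace = (J q).toBlocks₁₁.trace + (J q).toBlocks₂₂.trace := by
      simp [Matrix.trace, Fintype.sum_sum_type, toBlocks₁₁, toBlocks₂₂]
    rw [e1, e2, hτ, Matrix.trace_sub, Matrix.mul_assoc, Matrix.trace_mul_comm, Matrix.mul_assoc]
    ring
  have hquad : ∑ i, ptil t i * ∑ j, (∑ a, J q (Sum.inl i) (Sum.inr a) *
        J q (Sum.inr a) (Sum.inl j)) * ((g q).toBlocks₁₁⁻¹ *ᵥ ptil t) j =
      ptil t ⬝ᵥ (((J q).toBlocks₁₂ * (J q).toBlocks₂₁) *ᵥ ((g q).toBlocks₁₁⁻¹ *ᵥ ptil t)) := rfl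
  have hd := hJ1 q hx
  rw [quadHam, sum_sum_mul_eq_dotProduct, cofA_eq J hd hn, ← hτ,
    hA.inv_metric_eq_fromBlocks hg hx, Matrix.smul_mul, Matrix.smul_mulVec, dotProduct_smul,
    smul_eq_mul, hdr, hpe, hold, residual, ← htr, hquad]
  -- The block form of the inverse metric was also put into the cross term; it is folded back there
  -- so that `hcross` applies.
  rw [← hA.inv_metric_eq_fromBlocks hg hx]
  simp only [hcross]
  rw [sum_sum_mul_eq_dotProduct, hA.inv_metric_eq_fromBlocks hg hx, mul_add,
    mul_left_comm (1 / 2 : ℝ), inv_mul_cancel_left₀ hd, dotProduct_comm (ydot t)]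
  linarith

end Transformation

end DrivenCofactor

/-! ### The theorem. -/

open DrivenCofactor
theorem lemma2 {m n : ℕ}
    (U : Set (Fin m ⊕ Fin n → ℝ)) (hU : IsOpen U)
    (hslice : ∀ y : Fin m → ℝ, IsPreconnected {x : Fin n → ℝ | Sum.elim y x ∈ U})
    (g : (Fin m ⊕ Fin n → ℝ) → Matrix (Fin m ⊕ Fin n) (Fin m ⊕ Fin n) ℝ)
    (μ : (Fin m ⊕ Fin n → ℝ) → Fin m ⊕ Fin n → ℝ)
    (J : (Fin m ⊕ Fin n → ℝ) → Matrix (Fin m ⊕ Fin n) (Fin m ⊕ Fin n) ℝ)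
    (K : (Fin m ⊕ Fin n → ℝ) → (Fin m ⊕ Fin n → ℝ) → Submodule ℝ (Fin m ⊕ Fin n → ℝ))
    (hsys : IsDrivenCofactorSystem U g μ J K)
    (hadapted : IsAdapted U g K)
    (hJ1 : ∀ q ∈ U, (J q).toBlocks₁₁.det ≠ 0)
    (W V : (Fin m ⊕ Fin n → ℝ) → ℝ) (ψ : Fin m → (Fin m ⊕ Fin n → ℝ) → ℝ)
    (hW : IsPotentialW U μ J n W) (hV : IsDrivenPotential U μ V) (hψ : IsPsi U J ψ)
    (I : Set ℝ) (hI : IsOpen I) (y ptil : ℝ → Fin m → ℝ)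
    (hy : IsDrivingSolution U g μ J I y ptil) :
    (∀ t ∈ I, ∀ x p X P : Fin n → ℝ, Sum.elim (y t) x ∈ U →
      (GenRel (genF ψ y ptil) t x p X P ↔
        X = x ∧
        ∀ a, p a = P a + ∑ i, J (Sum.elim (y t) x) (Sum.inl i) (Sum.inr a) * ptil t i)) ∧
    ∃ c : ℝ → ℝ,
      IsTransformedHam (genF ψ y ptil) {z | z.1 ∈ I ∧ Sum.elim (y z.1) z.2 ∈ U}
        (drivenHam g V y)
        (fun x P t =>
          ((J (Sum.elim (y t) x)).toBlocks₁₁.det)⁻¹ *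
              quadHam g (cofA J n) W (Sum.elim (y t) x)
                (oldMomenta (J (Sum.elim (y t) x)) (ptil t) P)
            + (∑ a, ∑ i,
                (J (Sum.elim (y t) x) * (g (Sum.elim (y t) x))⁻¹) (Sum.inr a) (Sum.inl i) *
                  P a * ptil t i)
            + c t) := by
  refine ⟨fun t _ x p X P hx => genRel_genF_iff hU hψ hx, ?_⟩
  obtain ⟨ydot, hmot⟩ := hy.exists_isDrivingMotion hsys hadapted hU hslice
  -- The condition `t ∈ I` stands inside the existential so that `choose` gives a function on all of
  -- `ℝ`; its value outside `I` is arbitrary.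
  have hconst : ∀ t, ∃ c, t ∈ I → ∀ x, Sum.elim (y t) x ∈ U →
      residual J W V ψ (J (Sum.elim (y t) x)).toBlocks₁₁ (ydot t) (ptil t)
        (fun j => deriv (fun s => ptil s j) t)
        (Matrix.mulVec (g (Sum.elim (y t) x)).toBlocks₁₁⁻¹ (ptil t)) (Sum.elim (y t) x) = c := by
    intro t
    by_cases ht : t ∈ I
    swap
    · exact ⟨0, fun h => absurd h ht⟩
    obtain ⟨x₀, hx₀⟩ := hmot.nonempty t ht
    refine ⟨residual J W V ψ (J (Sum.elim (y t) x₀)).toBlocks₁₁ (ydot t) (ptil t)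
      (fun j => deriv (fun s => ptil s j) t)
      (Matrix.mulVec (g (Sum.elim (y t) x₀)).toBlocks₁₁⁻¹ (ptil t)) (Sum.elim (y t) x₀),
      fun _ x hx => ?_⟩
    -- The parameters of the residual are fixed at `x₀`, so that only its last argument varies on
    -- the slice.
    rw [block11_eq_of_slice hsys hadapted hU (hslice _) hx hx₀,
      metric11_eq_of_slice hsys hadapted hU (hslice _) hx hx₀]
    have hres := fun x (hx : Sum.elim (y t) x ∈ U) b =>
      hmot.pd_inr_residual hsys hadapted hU hI hJ1 hW hV hψ ht hx b
        (r := Matrix.mulVec (g (Sum.elim (y t) x₀)).toBlocks₁₁⁻¹ (ptil t))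
        (block11_eq_of_slice hsys hadapted hU (hslice _) hx hx₀) (by
          rw [metric11_eq_of_slice hsys hadapted hU (hslice _) hx hx₀, Matrix.mulVec_mulVec,
            Matrix.mul_nonsing_inv _ (isUnit_iff_ne_zero.mpr
              (hadapted.det_metric_blocks hsys.cofactor.metric hx₀).1), Matrix.one_mulVec])
    exact eq_of_pd_inr_eq_zero hU (hslice _)
      -- Any driven direction supplies differentiability; one exists because the coupling condition
      -- forces `0 < n`.
      (fun x hx => (hres x hx ⟨0, hsys.pos_of_isAdapted hadapted⟩).1)
      (fun x hx b => (hres x hx b).2) hx hx₀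
  choose c hc using hconst
  refine ⟨c, fun t x p X P hD hrel => ?_⟩
  obtain ⟨ht, hx⟩ : t ∈ I ∧ Sum.elim (y t) x ∈ U := hD
  obtain ⟨rfl, hp⟩ := (genRel_genF_iff hU hψ hx).mp hrel
  -- Replacing `c t` by the residual at the current point reduces the claim to the pointwise
  -- identity, which also fixes the value of `∂F/∂t`.
  refine ⟨_, ?_, (congrArg _ (hc t ht X hx).symm).trans
    (hmot.transformed_hamiltonian hsys hadapted hJ1 ht hx hp _)⟩
  refine HasDerivAt.const_add _ (HasDerivAt.fun_sum fun i _ => ?_)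
  exact (hasDerivAt_comp_sumElim_left
    (differentiableAt_of_contDiffOn hU (hψ.smooth i) hx) (hmot.deriv_y t ht)).mul
    (hmot.differentiableAt_ptil hsys hU hI hJ1 ht i).hasDerivAt
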